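/- Let $(M,g)$ be a smooth 4-dimensional manifold with a smooth metric of signature $(-1,1,1,1)$ and Levi-Civita connection $\nabla$. **Definitions.** A foliation of $M$ by surfaces is described by its field of tangent planes $D$: about every point there is a chart $(x^1,\dots,x^4)$ in which $D=\ker dx^3\cap\ker dx^4$ (an *adapted chart*; its slices $x^3,x^4=\mathrm{const}$ are the pieces of the leaves). A plane field that arises in this way is called integrable. The foliation is *null* if $g$ restricted to $D$ is degenerate. An *adapted frame* for it is a quadruple of smooth vector fields $(s,l,\alpha^\sharp,n)$ with $D=\mathrm{span}\{l,s\}$, with $l,n$ null, $g(s,s)=g(\alpha^\sharp,\alpha^\sharp)=1$, $g(l,n)=-1$, and all other products zero. A *null geodesic congruence* is given by a smooth nowhere vanishing null vector field $l$ with $\nabla_l l$ proportional to $l$ (its integral curves are geodesics up to parametrization). For such an $l$ tangent to $D$, put $\theta=\frac12\big[g(\nabla_s l,s)+g(\nabla_{\alpha^\sharp}l,\alpha^\sharp)\big]$; the foliation *admits an equipartition of null mean curvature with respect to $l$* if $\theta=g(\nabla_s l,s)$ at each point, for adapted frames at the point that contain $l$. A *null field sheet foliation* is a null foliation for which there is a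 null geodesic congruence $l$ tangent to $D$ with respect to which it admits an equipartition of null mean curvature. A smooth 2-form $F$ on an open set is a *null force-free field* if $dF=0$, $F(j^\sharp,\cdot)=0$ for $j=*d*F$, and $F_{ab}F^{ab}=0$. **Theorem.** Let $\mathcal F$ be a null field sheet foliation of $M$ and $(s,l,\alpha^\sharp,n)$ an adapted frame for it. Suppose that $l$ admits a uniform equipartition of null mean curvature, i.e. $g(\nabla_s l,\alpha^\sharp)+g(\nabla_{\alpha^\sharp}l,s)=0$ everywhere. Let $A,B$ be smooth functions on $M$ such that $\hat s=As+B\alpha^\sharp$ is a unit vector field and $\mathrm{span}\{l,\hat s\}$ is integrable, hence the tangent plane field of a foliation $\hat{\mathcal F}$. Then: 1. $\hat{\mathcal F}$ is a null field sheet foliation; moreover, every null geodesic congruence tangent to $\mathcal F$ with respect to which $\mathcal F$ admits an equipartition of null mean curvature is tangent to $\hat{\mathcal F}$, and $\hat{\mathcal F}$ admits an equipartition of null mean curvature with respect to it. 2. With $\hat\alpha^\sharp=-Bs+A\alpha^\sharp$, $(\hat s,l,\hat\alpha^\sharp,n)$ is an adapted frame for $\hat{\mathcal F}$. 3. For every chart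 $(U;x^1,\dots,x^4)$ adapted to $\hat{\mathcal F}$ and every smooth function $u=u(x^3,x^4)$ on $U$, the 2-form $\hat F=(u\cdot\hat\kappa)\,\hat\alpha\wedge l^\flat$, where $\hat\kappa=(\hat\alpha_3 l^\flat_4-\hat\alpha_4 l^\flat_3)^{-1}$ in the chart, is a null force-free field on $U$; it equals $u\,dx^3\wedge dx^4$, and where $u\neq0$ its kernel is exactly the tangent plane $\mathrm{span}\{l,\hat s\}$ of $\hat{\mathcal F}$. -/

import Mathlib

open scoped Manifold ContDiff Bundle
open VectorField Bundle

noncomputable section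

/-- The model space `ℝ⁴`. -/
abbrev E4 : Type := EuclideanSpace ℝ (Fin 4)

/-- The sign `(-1, 1, 1, 1)` of the `i`-th vector of a Lorentz orthonormal basis. -/
def lorentzSign (i : Fin 4) : ℝ := if i = 0 then -1 else 1

/-- A smooth metric of signature `(-1, 1, 1, 1)` on a 4-manifold. -/
structure LorentzMetric (M : Type*) [TopologicalSpace M] [ChartedSpace E4 M]
    [IsManifold (𝓡 4) ∞ M] where
  /-- the bilinear form on each tangent space -/
  val : ∀ x : M, TangentSpace (𝓡 4) x →L[ℝ] TangentSpace (𝓡 4) x →L[ℝ] ℝ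
  symm : ∀ (x : M) (v w : TangentSpace (𝓡 4) x), val x v w = val x w v
  signature : ∀ x : M, ∃ e : Module.Basis (Fin 4) ℝ (TangentSpace (𝓡 4) x),
    ∀ i j, val x (e i) (e j) = if i = j then lorentzSign i else 0
  smooth : ContMDiff (𝓡 4) ((𝓡 4).prod 𝓘(ℝ, E4 →L[ℝ] E4 →L[ℝ] ℝ)) ∞
    (fun x ↦ TotalSpace.mk' (E4 →L[ℝ] E4 →L[ℝ] ℝ) x (val x))

section Metric

variable {M : Type*} [TopologicalSpace M] [ChartedSpace E4 M] [IsManifold (𝓡 4) ∞ M]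

/-- A vector field on `M`, not necessarily continuous. -/
abbrev VField (M : Type*) [TopologicalSpace M] [ChartedSpace E4 M] : Type _ :=
  ∀ x : M, TangentSpace (𝓡 4) x

/-- Smoothness of a vector field. -/
def IsSmoothField (X : VField M) : Prop :=
  ContMDiff (𝓡 4) (𝓡 4).tangent ∞ (fun x ↦ (⟨x, X x⟩ : TangentBundle (𝓡 4) M))

/-- Differentiability of a vector field at a point. -/
abbrev DiffFieldAt (X : VField M) (x : M) : Prop :=
  MDifferentiableAt (𝓡 4) (𝓡 4).tangent (fun y ↦ (⟨y, X y⟩ : TangentBundle (𝓡 4) M)) x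

namespace LorentzMetric

variable (g : LorentzMetric M)

theorem nondegenerate (x : M) (v : TangentSpace (𝓡 4) x) (hv : ∀ w, g.val x v w = 0) :
    v = 0 := by
  obtain ⟨e, he⟩ := g.signature x
  refine e.ext_elem fun i ↦ ?_
  have h := hv (e i)
  rw [← e.sum_repr v] at h
  simp only [map_sum, map_smul, FunLike.coe_sum, FunLike.coe_smul,
    Finset.sum_apply, Pi.smul_apply, he, smul_eq_mul, mul_ite, mul_zero, Finset.sum_ite_eq',
    Finset.mem_univ, if_true] at h
  have hs : lorentzSign i ≠ 0 := by unfold lorentzSign; split_ifs <;> norm_num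
  simpa using (mul_eq_zero.1 h).resolve_right hs

instance (x : M) : FiniteDimensional ℝ (TangentSpace (𝓡 4) x) :=
  inferInstanceAs (FiniteDimensional ℝ E4)

instance (x : M) : T2Space (TangentSpace (𝓡 4) x) :=
  inferInstanceAs (T2Space E4)

/-- The musical isomorphism `♭`, `v ↦ g(v, ·)`. -/
def flat (x : M) :
    TangentSpace (𝓡 4) x ≃ₗ[ℝ] (TangentSpace (𝓡 4) x →L[ℝ] ℝ) :=
  LinearEquiv.ofInjectiveOfFinrankEq (g.val x).toLinearMap
    ((injective_iff_map_eq_zero _).2 fun v hv ↦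
      g.nondegenerate x v fun w ↦ congrArg (fun f ↦ f w) hv)
    (by
      rw [(LinearMap.toContinuousLinearMap (𝕜 := ℝ) (E := TangentSpace (𝓡 4) x)
        (F' := ℝ)).symm.finrank_eq]
      exact (Subspace.dual_finrank_eq (K := ℝ) (V := TangentSpace (𝓡 4) x)).symm)

theorem flat_apply (x : M) (v w : TangentSpace (𝓡 4) x) : g.flat x v w = g.val x v w := rfl

/-- The musical isomorphism `♯`, inverse to `♭`. -/
def sharp (x : M) (β : TangentSpace (𝓡 4) x →L[ℝ] ℝ) : TangentSpace (𝓡 4) x :=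
  (g.flat x).symm β

theorem val_sharp (x : M) (β : TangentSpace (𝓡 4) x →L[ℝ] ℝ) (w : TangentSpace (𝓡 4) x) :
    g.val x (g.sharp x β) w = β w := by
  rw [← flat_apply, sharp, LinearEquiv.apply_symm_apply]

/-- The function `g(X, Y)`. -/
def pair (X Y : VField M) (x : M) : ℝ := g.val x (X x) (Y x)

/-- The right-hand side of the Koszul formula. -/
def koszul (X Y Z : VField M) (x : M) : ℝ :=
  mvfderiv (𝓡 4) (g.pair Y Z) x (X x) + mvfderiv (𝓡 4) (g.pair X Z) x (Y x) - mvfderiv (𝓡 4) (g.pair X Y) x (Z x)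
    + g.val x (mlieBracket (𝓡 4) X Y x) (Z x)
    - g.val x (mlieBracket (𝓡 4) X Z x) (Y x)
    - g.val x (mlieBracket (𝓡 4) Y Z x) (X x)

variable {g}

theorem mdifferentiableAt_pair {X Y : VField M} {x : M}
    (hX : DiffFieldAt X x) (hY : DiffFieldAt Y x) : MDifferentiableAt (𝓡 4) 𝓘(ℝ, ℝ) (g.pair X Y) x := by
  have hg : MDifferentiableAt (𝓡 4) ((𝓡 4).prod 𝓘(ℝ, E4 →L[ℝ] E4 →L[ℝ] ℝ))
      (fun x ↦ TotalSpace.mk' (E4 →L[ℝ] E4 →L[ℝ] ℝ) x (g.val x)) x :=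
    (g.smooth x).mdifferentiableAt (by simp)
  have : MDifferentiableAt (𝓡 4) ((𝓡 4).prod 𝓘(ℝ, ℝ))
      (fun m ↦ TotalSpace.mk' ℝ (E := Bundle.Trivial M ℝ) m (g.val m (X m) (Y m))) x := by
    apply MDifferentiableAt.clm_bundle_apply₂ (F₁ := E4) (F₂ := E4)
    · exact hg
    · exact hX
    · exact hY
  simp only [mdifferentiableAt_totalSpace] at this
  exact this.2

theorem pair_add_left (X X' Y : VField M) : g.pair (X + X') Y = g.pair X Y + g.pair X' Y := by
  ext y; simp [pair]

theorem pair_add_right (X Y Y' : VField M) : g.pair X (Y + Y') = g.pair X Y + g.pair X Y' := by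
  ext y; simp [pair]

theorem pair_smul_left (f : M → ℝ) (X Y : VField M) : g.pair (f • X) Y = f * g.pair X Y := by
  ext y; simp [pair]

theorem pair_smul_right (f : M → ℝ) (X Y : VField M) : g.pair X (f • Y) = f * g.pair X Y := by
  ext y; simp [pair]

theorem koszul_tensorial_left {Y Z : VField M} {x : M}
    (hY : DiffFieldAt Y x) (hZ : DiffFieldAt Z x) :
    TensorialAt (𝓡 4) E4 (fun X ↦ g.koszul X Y Z x) x where
  smul {f X} hf hX := by
    have h1 := mdifferentiableAt_pair (g := g) hX hZ
    have h2 := mdifferentiableAt_pair (g := g) hX hY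
    simp only [koszul, pair_smul_left, mvfderiv_mul hf h1, mvfderiv_mul hf h2,
      mlieBracket_smul_left hf hX]
    simp [pair]
    ring
  add {X X'} hX hX' := by
    have h1 := mdifferentiableAt_pair (g := g) hX hZ
    have h2 := mdifferentiableAt_pair (g := g) hX hY
    have h1' := mdifferentiableAt_pair (g := g) hX' hZ
    have h2' := mdifferentiableAt_pair (g := g) hX' hY
    simp only [koszul, pair_add_left, mvfderiv_add h1 h1', mvfderiv_add h2 h2',
      mlieBracket_add_left hX hX']
    simp
    ring

theorem koszul_tensorial_right {X Y : VField M} {x : M}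
    (hX : DiffFieldAt X x) (hY : DiffFieldAt Y x) :
    TensorialAt (𝓡 4) E4 (fun Z ↦ g.koszul X Y Z x) x where
  smul {f Z} hf hZ := by
    have h1 := mdifferentiableAt_pair (g := g) hY hZ
    have h2 := mdifferentiableAt_pair (g := g) hX hZ
    simp only [koszul, pair_smul_right, mvfderiv_mul hf h1, mvfderiv_mul hf h2,
      mlieBracket_smul_right hf hZ]
    simp [pair, g.symm x (Z x)]
    ring
  add {Z Z'} hZ hZ' := by
    have h1 := mdifferentiableAt_pair (g := g) hY hZ
    have h2 := mdifferentiableAt_pair (g := g) hX hZ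
    have h1' := mdifferentiableAt_pair (g := g) hY hZ'
    have h2' := mdifferentiableAt_pair (g := g) hX hZ'
    simp only [koszul, pair_add_right, mvfderiv_add h1 h1', mvfderiv_add h2 h2',
      mlieBracket_add_right hZ hZ']
    simp
    ring

variable (g)

open Classical in
/-- The Levi-Civita connection: `g.nabla Y x v` is `(∇_v Y)(x)`, the vector determined by the
Koszul formula `2 g(∇_X Y, Z) = koszul X Y Z`. (If `Y` is not differentiable at `x`, the value
is `0`.) -/
def nabla (Y : VField M) (x : M) (v : TangentSpace (𝓡 4) x) : TangentSpace (𝓡 4) x :=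
  if hY : DiffFieldAt Y x then
    g.sharp x ((1 / 2 : ℝ) • TensorialAt.mkHom₂ (fun X Z ↦ g.koszul X Y Z x) x
      (fun _ hZ ↦ koszul_tensorial_left hY hZ) (fun _ hX ↦ koszul_tensorial_right hX hY) v)
  else 0

theorem two_mul_val_nabla {X Y Z : VField M} {x : M}
    (hX : DiffFieldAt X x) (hY : DiffFieldAt Y x) (hZ : DiffFieldAt Z x) :
    2 * g.val x (g.nabla Y x (X x)) (Z x) = g.koszul X Y Z x := by
  rw [nabla, dif_pos hY, val_sharp, FunLike.coe_smul, Pi.smul_apply,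
    TensorialAt.mkHom₂_apply _ _ hX hZ, smul_eq_mul]
  ring

/-- `∇` is compatible with the metric. -/
theorem nabla_metric {X Y Z : VField M} {x : M}
    (hX : DiffFieldAt X x) (hY : DiffFieldAt Y x) (hZ : DiffFieldAt Z x) :
    mvfderiv (𝓡 4) (g.pair Y Z) x (X x) =
      g.val x (g.nabla Y x (X x)) (Z x) + g.val x (Y x) (g.nabla Z x (X x)) := by
  have h1 := g.two_mul_val_nabla hX hY hZ
  have h2 := g.two_mul_val_nabla hX hZ hY
  have h3 : g.pair Z Y = g.pair Y Z := by ext y; exact g.symm y _ _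
  rw [g.symm x (Y x)]
  simp only [koszul, h3, mlieBracket_swap_apply (V := Z) (W := Y), map_neg,
    FunLike.coe_neg, Pi.neg_apply] at h1 h2
  linarith

/-- `∇` is torsion-free. -/
theorem nabla_torsion_free {X Y : VField M} {x : M}
    (hX : DiffFieldAt X x) (hY : DiffFieldAt Y x) :
    g.nabla Y x (X x) - g.nabla X x (Y x) = mlieBracket (𝓡 4) X Y x := by
  rw [← sub_eq_zero]
  refine g.nondegenerate x _ fun w ↦ ?_
  have hw : DiffFieldAt (FiberBundle.extend E4 w) x :=
    FiberBundle.mdifferentiableAt_extend ..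
  have h1 := g.two_mul_val_nabla hX hY hw
  have h2 := g.two_mul_val_nabla hY hX hw
  have h3 : g.pair Y X = g.pair X Y := by ext y; exact g.symm y _ _
  simp only [koszul, h3, mlieBracket_swap_apply (V := Y) (W := X), map_neg,
    FunLike.coe_neg, Pi.neg_apply, FiberBundle.extend_apply_self] at h1 h2
  simp only [map_sub, FunLike.coe_sub, Pi.sub_apply]
  linarith

end LorentzMetric

/-! ### Differential forms -/

/-- A field of `k`-forms on `M`, not necessarily continuous. -/
abbrev FormField (k : ℕ) (M : Type*) [TopologicalSpace M] [ChartedSpace E4 M] : Type _ :=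
  ∀ x : M, TangentSpace (𝓡 4) x [⋀^Fin k]→L[ℝ] ℝ

/-- The wedge product `β₁ ∧ ⋯ ∧ β_k` of covectors: `(v₁, …, v_k) ↦ det (β_i (v_j))`. -/
def wedgeForm {V : Type*} [AddCommGroup V] [Module ℝ V] [TopologicalSpace V] {k : ℕ}
    (β : Fin k → V →L[ℝ] ℝ) : V [⋀^Fin k]→L[ℝ] ℝ :=
  ContinuousMultilinearMap.alternatization
    ((ContinuousMultilinearMap.mkPiAlgebra ℝ (Fin k) ℝ).compContinuousLinearMap β)

theorem wedgeForm_apply {V : Type*} [AddCommGroup V] [Module ℝ V] [TopologicalSpace V] {k : ℕ}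
    (β : Fin k → V →L[ℝ] ℝ) (v : Fin k → V) :
    wedgeForm β v = Matrix.det (Matrix.of fun i j ↦ β i (v j)) := by
  rw [← Matrix.det_transpose, Matrix.det_apply, wedgeForm,
    ContinuousMultilinearMap.alternatization_apply_apply]
  simp

/-- The interior product `i_v ω = ω(v, ·, …, ·)`. -/
def intProd {V : Type*} [AddCommGroup V] [Module ℝ V] [TopologicalSpace V] {k : ℕ}
    (v : V) (η : V [⋀^Fin (k + 1)]→L[ℝ] ℝ) : V [⋀^Fin k]→L[ℝ] ℝ :=
  { η.toAlternatingMap.curryLeft v with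
    cont := η.cont.comp (continuous_const.matrixVecCons continuous_id) }

theorem intProd_apply {V : Type*} [AddCommGroup V] [Module ℝ V] [TopologicalSpace V] {k : ℕ}
    (v : V) (η : V [⋀^Fin (k + 1)]→L[ℝ] ℝ) (w : Fin k → V) :
    intProd v η w = η (Matrix.vecCons v w) := rfl

/-- The pull-back of a form to the model space by the inverse of the preferred chart at `x₀`. -/
def chartPullback {k : ℕ} (x₀ : M) (η : FormField k M) (y : E4) : E4 [⋀^Fin k]→L[ℝ] ℝ :=
  (η ((extChartAt (𝓡 4) x₀).symm y)).compContinuousLinearMap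
    (mfderiv 𝓘(ℝ, E4) (𝓡 4) (extChartAt (𝓡 4) x₀).symm y)

/-- Smoothness of a form on a set. -/
def IsSmoothFormOn {k : ℕ} (η : FormField k M) (U : Set M) : Prop :=
  ∀ x ∈ U, ContDiffAt ℝ ∞ (chartPullback x η) (extChartAt (𝓡 4) x x)

/-- The exterior derivative `dη`. -/
def extD {k : ℕ} (η : FormField k M) : FormField (k + 1) M := fun x ↦
  (extDeriv (chartPullback x η) (extChartAt (𝓡 4) x x)).compContinuousLinearMap
    (mfderiv (𝓡 4) 𝓘(ℝ, E4) (extChartAt (𝓡 4) x) x)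

/-- The coordinate 1-form `dxⁱ` of a chart. -/
def coordForm (φ : OpenPartialHomeomorph M E4) (i : Fin 4) (x : M) :
    TangentSpace (𝓡 4) x →L[ℝ] ℝ :=
  (EuclideanSpace.proj i : E4 →L[ℝ] ℝ).comp (mfderiv (𝓡 4) 𝓘(ℝ, E4) φ x)

/-- The coordinate vector field `∂/∂xⁱ` of a chart, the preimage of the `i`-th standard basis
vector under the differential of the chart. -/
def coordVec (φ : OpenPartialHomeomorph M E4) (i : Fin 4) : VField M := fun x ↦
  (mfderiv (𝓡 4) 𝓘(ℝ, E4) φ x).inverse (EuclideanSpace.single i (1 : ℝ))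

namespace LorentzMetric

variable (g : LorentzMetric M)

/-- A Lorentz orthonormal basis of the tangent space at `x`. -/
def basis (x : M) : Module.Basis (Fin 4) ℝ (TangentSpace (𝓡 4) x) :=
  Classical.choose (g.signature x)

/-- The metric volume form `√|det g_ij| dx⁰ ∧ dx¹ ∧ dx² ∧ dx³` near `x₀`, oriented by the
preferred chart at `x₀`. -/
def volForm (x₀ : M) : FormField 4 M := fun x ↦
  Real.sqrt |Matrix.det (Matrix.of fun i j ↦
      g.pair (coordVec (chartAt E4 x₀) i) (coordVec (chartAt E4 x₀) j) x)| •
    wedgeForm (fun i ↦ coordForm (chartAt E4 x₀) i x)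

/-- The Hodge star of 2-forms with respect to a volume form,
`(*F)_{cd} = (1/2) F^{ab} vol_{abcd}`, computed in a Lorentz orthonormal basis. -/
def hodge₂ (vol : FormField 4 M) (F : FormField 2 M) : FormField 2 M := fun x ↦
  (1 / 2 : ℝ) • ∑ i, ∑ j,
    (lorentzSign i * lorentzSign j * F x ![g.basis x i, g.basis x j]) •
      intProd (g.basis x j) (intProd (g.basis x i) (vol x))

/-- The Hodge star of 3-forms with respect to a volume form,
`(*J)_d = (1/6) J^{abc} vol_{abcd}`, computed in a Lorentz orthonormal basis. -/
def hodge₃ (vol : FormField 4 M) (J : FormField 3 M) : FormField 1 M := fun x ↦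
  (1 / 6 : ℝ) • ∑ i, ∑ j, ∑ k,
    (lorentzSign i * lorentzSign j * lorentzSign k *
        J x ![g.basis x i, g.basis x j, g.basis x k]) •
      intProd (g.basis x k) (intProd (g.basis x j) (intProd (g.basis x i) (vol x)))

/-- The current density 1-form `j = *d*F`. It contains the Hodge star twice, so it does not depend
on the local orientation, which is taken from the preferred chart at the point. -/
def current (F : FormField 2 M) : FormField 1 M := fun x ↦
  g.hodge₃ (g.volForm x) (extD (g.hodge₂ (g.volForm x) F)) x

/-- The current density vector `j♯`. -/
def currentVec (F : FormField 2 M) : VField M := fun x ↦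
  g.sharp x ((ContinuousAlternatingMap.ofSubsingleton ℝ (TangentSpace (𝓡 4) x) ℝ
    (0 : Fin 1)).symm (g.current F x))

/-- The invariant `F² = F_{ab} F^{ab}`. -/
def formSq (F : FormField 2 M) (x : M) : ℝ :=
  ∑ i, ∑ j, lorentzSign i * lorentzSign j * F x ![g.basis x i, g.basis x j] ^ 2

/-- `F` is a null force-free electromagnetic field on the open set `U`: it is smooth, it satisfies
the Maxwell equation `dF = 0`, the force-free condition `i_{j♯} F = 0` for `j = *d*F`, and
`F² = 0`. -/
structure IsNullForceFreeOn (F : FormField 2 M) (U : Set M) : Prop where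
  smooth : IsSmoothFormOn F U
  closed : ∀ x ∈ U, extD F x = 0
  force_free : ∀ x ∈ U, intProd (g.currentVec F x) (F x) = 0
  null : ∀ x ∈ U, g.formSq F x = 0

end LorentzMetric

/-! ### Foliations by surfaces -/

/-- A field of tangent subspaces. -/
abbrev PlaneField (M : Type*) [TopologicalSpace M] [ChartedSpace E4 M] : Type _ :=
  ∀ x : M, Submodule ℝ (TangentSpace (𝓡 4) x)

/-- The distribution spanned by two vector fields. -/
def spanField (X Y : VField M) : PlaneField M := fun x ↦ Submodule.span ℝ {X x, Y x}

/-- The chart `φ = (x⁰, x¹, x², x³)` is adapted to `D`: on its domain `D` consists of the vectors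
tangent to the slices on which the last two coordinates `x²`, `x³` are constant. -/
structure IsAdaptedChart (D : PlaneField M) (φ : OpenPartialHomeomorph M E4) : Prop where
  mem_atlas : φ ∈ IsManifold.maximalAtlas (𝓡 4) ∞ M
  mem_iff : ∀ x ∈ φ.source, ∀ v, v ∈ D x ↔ coordForm φ 2 x v = 0 ∧ coordForm φ 3 x v = 0

/-- `D` is the tangent distribution of a foliation of `M` by 2-dimensional submanifolds (`D` is
an integrable distribution): about each point there is an adapted chart, whose slices are the
pieces of the leaves in the chart domain. -/
def IsFoliation (D : PlaneField M) : Prop :=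
  ∀ p : M, ∃ φ : OpenPartialHomeomorph M E4, p ∈ φ.source ∧ IsAdaptedChart D φ

namespace LorentzMetric

variable (g : LorentzMetric M)

/-- A null foliation: a foliation by surfaces on which the metric is degenerate. -/
structure IsNullFoliation (D : PlaneField M) : Prop where
  foliation : IsFoliation D
  degenerate : ∀ x, ∃ v ∈ D x, v ≠ 0 ∧ ∀ w ∈ D x, g.val x v w = 0

/-- `(s, l, a, n)`, where `a` stands for `α♯`, is a null tetrad at `x` adapted to `D`. -/
structure IsAdaptedTetrad (D : PlaneField M) (x : M)
    (s l a n : TangentSpace (𝓡 4) x) : Prop where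
  span_eq : D x = Submodule.span ℝ {l, s}
  ll : g.val x l l = 0
  nn : g.val x n n = 0
  ss : g.val x s s = 1
  aa : g.val x a a = 1
  ln : g.val x l n = -1
  ls : g.val x l s = 0
  la : g.val x l a = 0
  sa : g.val x s a = 0
  sn : g.val x s n = 0
  an : g.val x a n = 0

/-- A null foliation adapted frame `(s, l, a, n)`, where `a` stands for `α♯`. -/
structure IsAdaptedFrame (D : PlaneField M) (s l a n : VField M) : Prop where
  smooth_s : IsSmoothField s
  smooth_l : IsSmoothField l
  smooth_a : IsSmoothField a
  smooth_n : IsSmoothField n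
  tetrad : ∀ x, g.IsAdaptedTetrad D x (s x) (l x) (a x) (n x)

/-- `l` generates a null geodesic congruence: it is a smooth, nowhere vanishing null vector field
whose integral curves are, up to parametrization, geodesics (`∇_l l` is proportional to `l`). -/
structure IsNullGeodesicCongruence (l : VField M) : Prop where
  smooth : IsSmoothField l
  ne_zero : ∀ x, l x ≠ 0
  null : ∀ x, g.val x (l x) (l x) = 0
  pregeodesic : ∀ x, ∃ c : ℝ, g.nabla l x (l x) = c • l x

/-- The null mean curvature (null expansion) of `l` at `x`, in terms of `s` and `a = α♯`. -/
def nullMeanCurvature (l : VField M) (x : M) (s a : TangentSpace (𝓡 4) x) : ℝ :=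
  (1 / 2) * (g.val x (g.nabla l x s) s + g.val x (g.nabla l x a) a)

/-- `D` admits an equipartition of null mean curvature with respect to `l`. -/
def AdmitsEquipartition (D : PlaneField M) (l : VField M) : Prop :=
  ∀ x s a n, g.IsAdaptedTetrad D x s (l x) a n →
    g.nullMeanCurvature l x s a = g.val x (g.nabla l x s) s

/-- `l` is a null geodesic congruence tangent to `D`, with respect to which `D` admits an
equipartition of null mean curvature. -/
structure IsFieldSheetCongruence (D : PlaneField M) (l : VField M) : Prop where
  congruence : g.IsNullGeodesicCongruence l
  tangent : ∀ x, l x ∈ D x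
  equipartition : g.AdmitsEquipartition D l

/-- A null field sheet foliation. -/
structure IsNullFieldSheetFoliation (D : PlaneField M) : Prop where
  null_foliation : g.IsNullFoliation D
  exists_congruence : ∃ l : VField M, g.IsFieldSheetCongruence D l

/-- `l` admits a uniform equipartition of null mean curvature, in terms of `s` and `a = α♯`. -/
def UniformEquipartition (s l a : VField M) : Prop :=
  ∀ x, g.val x (g.nabla l x (s x)) (a x) + g.val x (g.nabla l x (a x)) (s x) = 0

/-- The factor `κ = (α_i l_j - α_j l_i)⁻¹`, where `α = a♭` and where `i = 2`, `j = 3` are the last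
two coordinates of the chart `φ`. -/
def kappa (φ : OpenPartialHomeomorph M E4) (a l : VField M) (x : M) : ℝ :=
  (g.pair a (coordVec φ 2) x * g.pair l (coordVec φ 3) x -
    g.pair a (coordVec φ 3) x * g.pair l (coordVec φ 2) x)⁻¹

/-- The 2-form `(u · κ) α ∧ l♭`, where `α = a♭`, and where `u` is evaluated on the last two
coordinates of the chart `φ`. -/
def chartField (φ : OpenPartialHomeomorph M E4) (u : ℝ → ℝ → ℝ) (a l : VField M) :
    FormField 2 M := fun x ↦
  (u (φ x 2) (φ x 3) * g.kappa φ a l x) • wedgeForm ![g.val x (a x), g.val x (l x)]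

end LorentzMetric
end Metric

end

/-! Uniform equipartition makes equipartition insensitive to rotation. Consider the bilinear form
`(v, w) ↦ g(∇_v l, w)` on the screen plane `span{s, α♯}`. Equipartition says that its two diagonal
entries agree, and the uniform condition says that its off-diagonal entries cancel. The trace-free
symmetric part, the shear of `l`, therefore vanishes. Since `g(ŝ, ŝ) = 1` forces `A² + B² = 1`, the
pair `(ŝ, α̂♯)` is a rotation of `(s, α♯)`, and a vanishing shear vanishes in every rotated frame
(`IsEquipartitioned.rotate`).

The frame field `l` is not assumed pregeodesic, and the given congruence is only a pointwise
multiple `f • l` of it. All conditions are therefore recorded for the frame itself in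
`IsEquipartitioned`. They pass from a congruence to the frame
(`IsFieldSheetCongruence.isEquipartitioned`) and back to any congruence parallel to `l`
(`IsEquipartitioned.isFieldSheetCongruence`). Every field sheet congruence of the first foliation is
parallel to `l`, because the null vectors of `span{l, s}` are multiples of `l`.

For the form, both `α̂` and `l♭` annihilate the tangent planes, so in an adapted chart their wedge
is a multiple of the wedge of the last two coordinate differentials, and `κ̂` normalizes that
multiple. What remains is `u` times this wedge, with `u` a function of the same two coordinates: it
is closed and its kernel is the plane field. Nullness is the vanishing of the Gram determinant of
`α̂♯` and `l`.

For the force-free condition write `F = w α♭ ∧ l♭`, with `α` now a vector field. The volume of the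
frame is locally a constant `σ = ±1`, so `*F = -σ w s♭ ∧ l♭`. By Cartan's formula `dF(l, α, n)` and
`d*F(l, s, n)` are, up to the factor `-σ`, the same expression, except that the expansion along `α`
is replaced by the one along `s`. As these agree, `dF = 0` kills the second too. Also `d*F(l, s, α)`
is proportional to `g(∇_l l, α) = 0`. These two components of `d*F` are the pairings of `j♯` with
`α` and `l`, up to factors, so `F(j♯, ·) = 0` (`IsAdaptedFrame.intProd_currentVec`). -/

noncomputable section

/-! ### Vector fields, brackets and the exterior derivative in charts -/

section Charts

set_option linter.unusedSectionVars false

open Set Filter Topology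

variable {M : Type*} [TopologicalSpace M] [ChartedSpace E4 M] [IsManifold (𝓡 4) ∞ M]

/-- Smoothness of a vector field at a point. -/
abbrev SmoothFieldAt (X : VField M) (x : M) : Prop :=
  ContMDiffAt (𝓡 4) (𝓡 4).tangent ∞ (fun y ↦ (⟨y, X y⟩ : TangentBundle (𝓡 4) M)) x

theorem SmoothFieldAt.diffFieldAt {X : VField M} {x : M} (h : SmoothFieldAt X x) :
    DiffFieldAt X x :=
  ContMDiffAt.mdifferentiableAt h (by simp)

theorem contMDiffAt_coordForm {φ : OpenPartialHomeomorph M E4}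
    (hφ : φ ∈ IsManifold.maximalAtlas (𝓡 4) ∞ M) {x : M} (hx : x ∈ φ.source) {X : VField M}
    (hX : SmoothFieldAt X x) (i : Fin 4) :
    ContMDiffAt (𝓡 4) 𝓘(ℝ, ℝ) ∞ (fun p ↦ coordForm φ i p (X p)) x := by
  have h1 := (contMDiffOn_of_mem_maximalAtlas hφ).contMDiffOn_tangentMapWithin (m := ∞)
    (by simp) φ.open_source.uniqueMDiffOn
  have h2 : ContMDiffAt (𝓡 4) (𝓡 4).tangent ∞
      (fun p ↦ tangentMapWithin (𝓡 4) (𝓡 4) φ φ.source ⟨p, X p⟩) x := by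
    refine ContMDiffAt.comp x (h1.contMDiffAt ?_) hX
    exact (φ.open_source.preimage (FiberBundle.continuous_proj E4 _)).mem_nhds hx
  have h3 := (contMDiff_snd_tangentBundle_modelSpace (n := ∞) E4 𝓘(ℝ, E4)).contMDiffAt.comp x h2
  have h4 := ((EuclideanSpace.proj i : E4 →L[ℝ] ℝ).contDiff (n := ∞)).contMDiff.contMDiffAt.comp
    x h3
  refine h4.congr_of_eventuallyEq ?_
  filter_upwards [φ.open_source.mem_nhds hx] with p hp
  simp only [coordForm, tangentMapWithin, Function.comp,
    mfderivWithin_of_isOpen φ.open_source hp]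
  rfl

theorem mdifferentiable_of_mem_maximalAtlas {φ : OpenPartialHomeomorph M E4}
    (hφ : φ ∈ IsManifold.maximalAtlas (𝓡 4) ∞ M) : φ.MDifferentiable (𝓡 4) (𝓡 4) :=
  ⟨(contMDiffOn_of_mem_maximalAtlas hφ).mdifferentiableOn (by simp),
    (contMDiffOn_symm_of_mem_maximalAtlas hφ).mdifferentiableOn (by simp)⟩

theorem isInvertible_mfderiv_chart {φ : OpenPartialHomeomorph M E4}
    (hφ : φ ∈ IsManifold.maximalAtlas (𝓡 4) ∞ M) {x : M} (hx : x ∈ φ.source) :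
    (mfderiv (𝓡 4) 𝓘(ℝ, E4) φ x).IsInvertible :=
  ⟨(mdifferentiable_of_mem_maximalAtlas hφ).mfderiv hx, rfl⟩

theorem coordForm_coordVec {φ : OpenPartialHomeomorph M E4}
    (hφ : φ ∈ IsManifold.maximalAtlas (𝓡 4) ∞ M) {x : M} (hx : x ∈ φ.source) (i j : Fin 4) :
    coordForm φ i x (coordVec φ j x) = if i = j then 1 else 0 := by
  have h : mfderiv (𝓡 4) 𝓘(ℝ, E4) φ x (coordVec φ j x) = EuclideanSpace.single j (1 : ℝ) :=
    (isInvertible_mfderiv_chart hφ hx).self_apply_inverse _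
  refine (congrArg (EuclideanSpace.proj i : E4 →L[ℝ] ℝ) h).trans ?_
  simp

theorem sum_coordForm_smul_coordVec {φ : OpenPartialHomeomorph M E4}
    (hφ : φ ∈ IsManifold.maximalAtlas (𝓡 4) ∞ M) {x : M} (hx : x ∈ φ.source)
    (v : TangentSpace (𝓡 4) x) :
    ∑ i, coordForm φ i x v • coordVec φ i x = v := by
  have hinv := isInvertible_mfderiv_chart hφ hx
  apply hinv.injective
  rw [map_sum]
  have h : ∀ i, mfderiv (𝓡 4) 𝓘(ℝ, E4) φ x (coordForm φ i x v • coordVec φ i x) =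
      (show E4 from mfderiv (𝓡 4) 𝓘(ℝ, E4) φ x v) i • (EuclideanSpace.single i (1 : ℝ) : E4) := fun i ↦ by
    rw [map_smul]
    exact congrArg (coordForm φ i x v • ·)
      (hinv.self_apply_inverse (EuclideanSpace.single i (1 : ℝ)))
  refine (Finset.sum_congr rfl fun i _ ↦ h i).trans ?_
  have key : ∀ w : E4, ∑ i, w i • EuclideanSpace.single i (1 : ℝ) = w := fun w ↦ by
    simpa using (EuclideanSpace.basisFun (Fin 4) ℝ).sum_repr w
  exact key _

theorem mem_target_nhds (x : M) :
    (extChartAt (𝓡 4) x).target ∈ 𝓝 (extChartAt (𝓡 4) x x) :=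
  extChartAt_target_mem_nhds x

theorem isInvertible_mfderiv_symm {x : M} {y : E4} (hy : y ∈ (extChartAt (𝓡 4) x).target) :
    (mfderiv 𝓘(ℝ, E4) (𝓡 4) (extChartAt (𝓡 4) x).symm y).IsInvertible := by
  have := isInvertible_mfderivWithin_extChartAt_symm hy
  rwa [ModelWithCorners.range_eq_univ, mfderivWithin_univ] at this

theorem mfderiv_comp_mfderiv_symm {x : M} {y : E4} (hy : y ∈ (extChartAt (𝓡 4) x).target)
    (v : E4) :
    mfderiv (𝓡 4) 𝓘(ℝ, E4) (extChartAt (𝓡 4) x) ((extChartAt (𝓡 4) x).symm y)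
      (mfderiv 𝓘(ℝ, E4) (𝓡 4) (extChartAt (𝓡 4) x).symm y v) = v := by
  have := mfderiv_extChartAt_comp_mfderivWithin_extChartAt_symm hy
  rw [ModelWithCorners.range_eq_univ, mfderivWithin_univ] at this
  exact congrArg (fun f ↦ f v) this

/-- The vector field `X` in the preferred chart at `x`. -/
def chartRep (x : M) (X : VField M) : E4 → E4 :=
  mpullback 𝓘(ℝ, E4) (𝓡 4) (extChartAt (𝓡 4) x).symm X

theorem mfderiv_symm_chartRep {x : M} {y : E4} (hy : y ∈ (extChartAt (𝓡 4) x).target)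
    (X : VField M) :
    mfderiv 𝓘(ℝ, E4) (𝓡 4) (extChartAt (𝓡 4) x).symm y (chartRep x X y) =
      X ((extChartAt (𝓡 4) x).symm y) :=
  (isInvertible_mfderiv_symm hy).self_apply_inverse _

theorem differentiableAt_chartRep {x : M} {X : VField M} (hX : DiffFieldAt X x) :
    DifferentiableAt ℝ (chartRep x X) (extChartAt (𝓡 4) x x) := by
  have h : MDifferentiableAt 𝓘(ℝ, E4) 𝓘(ℝ, E4).tangent
      (fun y ↦ (⟨y, chartRep x X y⟩ : TangentBundle 𝓘(ℝ, E4) E4)) (extChartAt (𝓡 4) x x) := by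
    refine MDifferentiableAt.mpullback_vectorField (n := 2) ?_ ?_
      (isInvertible_mfderiv_symm (mem_extChartAt_target x)) le_rfl
    · rwa [extChartAt_to_inv]
    · exact (contMDiffOn_extChartAt_symm x).contMDiffAt (mem_target_nhds x)
  have h3 := ((contMDiff_snd_tangentBundle_modelSpace (n := 1) E4
    𝓘(ℝ, E4)).contMDiffAt.mdifferentiableAt one_ne_zero).comp _ h
  exact h3.differentiableAt

theorem mfderiv_chart_apply (x : M) (X : VField M) :
    mfderiv (𝓡 4) 𝓘(ℝ, E4) (extChartAt (𝓡 4) x) x (X x) =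
      chartRep x X (extChartAt (𝓡 4) x x) := by
  have h1 := mfderiv_symm_chartRep (mem_extChartAt_target x) X
  have h2 := mfderiv_comp_mfderiv_symm (mem_extChartAt_target x)
    (chartRep x X (extChartAt (𝓡 4) x x))
  rw [h1] at h2
  rwa [extChartAt_to_inv] at h2

theorem mfderiv_chart_mlieBracket (x : M) (X Y : VField M) :
    mfderiv (𝓡 4) 𝓘(ℝ, E4) (extChartAt (𝓡 4) x) x (mlieBracket (𝓡 4) X Y x) =
      lieBracket ℝ (chartRep x X) (chartRep x Y) (extChartAt (𝓡 4) x x) := by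
  have h : mlieBracket (𝓡 4) X Y x = (mfderiv (𝓡 4) 𝓘(ℝ, E4) (extChartAt (𝓡 4) x) x).inverse
      (lieBracket ℝ (chartRep x X) (chartRep x Y) (extChartAt (𝓡 4) x x)) := by
    rw [← mlieBracketWithin_univ, mlieBracketWithin_apply, ModelWithCorners.range_eq_univ,
      mpullbackWithin_univ, mpullbackWithin_univ, preimage_univ, univ_inter]
    exact congrArg (mfderiv (𝓡 4) 𝓘(ℝ, E4) (extChartAt (𝓡 4) x) x).inverse
      (congrFun (lieBracketWithin_univ (V := chartRep x X) (W := chartRep x Y)) _)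
  rw [h]
  exact (isInvertible_mfderiv_extChartAt (mem_extChartAt_source x)).self_apply_inverse _

theorem fderiv_comp_symm {x : M} {q : M → ℝ} (hq : MDifferentiableAt (𝓡 4) 𝓘(ℝ, ℝ) q x)
    (X : VField M) :
    fderiv ℝ (fun y ↦ q ((extChartAt (𝓡 4) x).symm y)) (extChartAt (𝓡 4) x x)
      (chartRep x X (extChartAt (𝓡 4) x x)) = mvfderiv (𝓡 4) q x (X x) := by
  have h : MDifferentiableAt 𝓘(ℝ, E4) (𝓡 4) (extChartAt (𝓡 4) x).symm (extChartAt (𝓡 4) x x) :=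
    ((contMDiffOn_extChartAt_symm (n := 1) x).contMDiffAt (mem_target_nhds x)).mdifferentiableAt
      (by simp)
  have h1 := mvfderiv_comp_apply (g := q) (f := (extChartAt (𝓡 4) x).symm) (extChartAt (𝓡 4) x x)
    (by rwa [extChartAt_to_inv]) h (chartRep x X (extChartAt (𝓡 4) x x))
  rw [mfderiv_symm_chartRep (mem_extChartAt_target x), extChartAt_to_inv] at h1
  rw [← h1, mvfderiv, mfderiv_eq_fderiv]
  rfl

theorem chartPullback_chartRep {k : ℕ} {x : M} {y : E4}
    (hy : y ∈ (extChartAt (𝓡 4) x).target) (η : FormField k M) (X : Fin k → VField M) :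
    chartPullback x η y (fun i ↦ chartRep x (X i) y) =
      η ((extChartAt (𝓡 4) x).symm y) (fun i ↦ X i ((extChartAt (𝓡 4) x).symm y)) := by
  exact congrArg (η ((extChartAt (𝓡 4) x).symm y)) (funext fun i ↦ mfderiv_symm_chartRep hy (X i))

theorem chartPullback_two {x : M} {y : E4}
    (hy : y ∈ (extChartAt (𝓡 4) x).target) (η : FormField 2 M) (X Y : VField M) :
    chartPullback x η y ![chartRep x X y, chartRep x Y y] =
      η ((extChartAt (𝓡 4) x).symm y)
        ![X ((extChartAt (𝓡 4) x).symm y), Y ((extChartAt (𝓡 4) x).symm y)] := by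
  have h := chartPullback_chartRep hy η ![X, Y]
  have e1 : (fun i ↦ chartRep x (![X, Y] i) y) = ![chartRep x X y, chartRep x Y y] := by
    ext1 i; fin_cases i <;> rfl
  have e2 : (fun i ↦ (![X, Y] : Fin 2 → VField M) i ((extChartAt (𝓡 4) x).symm y)) =
      ![X ((extChartAt (𝓡 4) x).symm y), Y ((extChartAt (𝓡 4) x).symm y)] := by
    ext1 i; fin_cases i <;> rfl
  rwa [e1, e2] at h

/-- Cartan's formula for the exterior derivative of a 2-form. -/
theorem extD_apply {η : FormField 2 M} {X Y Z : VField M} {x : M}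
    (hη : DifferentiableAt ℝ (chartPullback x η) (extChartAt (𝓡 4) x x))
    (hX : DiffFieldAt X x) (hY : DiffFieldAt Y x) (hZ : DiffFieldAt Z x)
    (hXY : MDifferentiableAt (𝓡 4) 𝓘(ℝ, ℝ) (fun p ↦ η p ![X p, Y p]) x)
    (hXZ : MDifferentiableAt (𝓡 4) 𝓘(ℝ, ℝ) (fun p ↦ η p ![X p, Z p]) x)
    (hYZ : MDifferentiableAt (𝓡 4) 𝓘(ℝ, ℝ) (fun p ↦ η p ![Y p, Z p]) x) :
    extD η x ![X x, Y x, Z x] =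
      mvfderiv (𝓡 4) (fun p ↦ η p ![Y p, Z p]) x (X x)
      - mvfderiv (𝓡 4) (fun p ↦ η p ![X p, Z p]) x (Y x)
      + mvfderiv (𝓡 4) (fun p ↦ η p ![X p, Y p]) x (Z x)
      - η x ![mlieBracket (𝓡 4) X Y x, Z x]
      + η x ![mlieBracket (𝓡 4) X Z x, Y x]
      - η x ![mlieBracket (𝓡 4) Y Z x, X x] := by
  set y₀ := extChartAt (𝓡 4) x x with hy₀
  -- The flat-space formula is applied to the chart representatives; `hd` and `hb` carry its
  -- derivative terms and its bracket terms back to the manifold.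
  have key := extDeriv_apply_vectorField (V := ![chartRep x X, chartRep x Y, chartRep x Z]) hη
    (by intro i; fin_cases i
        exacts [differentiableAt_chartRep hX, differentiableAt_chartRep hY,
          differentiableAt_chartRep hZ])
  have hd : ∀ {P Q : VField M} (R : VField M),
      MDifferentiableAt (𝓡 4) 𝓘(ℝ, ℝ) (fun p ↦ η p ![P p, Q p]) x →
      fderiv ℝ (fun y ↦ chartPullback x η y ![chartRep x P y, chartRep x Q y]) y₀
        (chartRep x R y₀) = mvfderiv (𝓡 4) (fun p ↦ η p ![P p, Q p]) x (R x) := by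
    intro P Q R h
    rw [← fderiv_comp_symm h R]
    congr 1
    apply Filter.EventuallyEq.fderiv_eq
    filter_upwards [mem_target_nhds x] with y hy
    exact chartPullback_two hy η P Q
  have hb : ∀ P Q R : VField M,
      chartPullback x η y₀ ![lieBracket ℝ (chartRep x P) (chartRep x Q) y₀, chartRep x R y₀] =
        η x ![mlieBracket (𝓡 4) P Q x, R x] := by
    intro P Q R
    rw [← mfderiv_chart_mlieBracket, mfderiv_chart_apply x (mlieBracket (𝓡 4) P Q)]
    have h := chartPullback_two (mem_extChartAt_target x) η (mlieBracket (𝓡 4) P Q) R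
    rwa [extChartAt_to_inv] at h
  have hl : extD η x ![X x, Y x, Z x] = extDeriv (chartPullback x η) y₀
      (fun i ↦ (![chartRep x X, chartRep x Y, chartRep x Z] : Fin 3 → E4 → E4) i y₀) := by
    refine congrArg (extDeriv (chartPullback x η) y₀) (funext fun i ↦ ?_)
    fin_cases i <;> exact mfderiv_chart_apply x _
  rw [hl, key]
  have e0 : ∀ (V : Fin 3 → E4), Fin.removeNth 0 V = ![V 1, V 2] := fun V ↦ by
    ext1 i; fin_cases i <;> rfl
  have e1 : ∀ (V : Fin 3 → E4), Fin.removeNth 1 V = ![V 0, V 2] := fun V ↦ by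
    ext1 i; fin_cases i <;> rfl
  have e2 : ∀ (V : Fin 3 → E4), Fin.removeNth 2 V = ![V 0, V 1] := fun V ↦ by
    ext1 i; fin_cases i <;> rfl
  rw [← hd X hYZ, ← hd Y hXZ, ← hd Z hXY, ← hb, ← hb, ← hb]
  have f0 : Finset.Ici (0 : Fin 2) = {0, 1} := by decide
  have f1 : Finset.Ici (1 : Fin 2) = {1} := by decide
  have e3 : ∀ a b : E4, Fin.removeNth 1 ![a, b] = ![a] := fun a b ↦ by
    ext1 i; fin_cases i; rfl
  simp [Fin.sum_univ_succ, e0, e1, e2, e3, f0, f1]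
  ring

end Charts

/-! ### Smoothness of 2-forms, tested on coordinate components -/

section SmoothForms

set_option linter.unusedSectionVars false

open Set Filter Topology

theorem wedgeForm_two {V : Type*} [AddCommGroup V] [Module ℝ V] [TopologicalSpace V]
    (α β : V →L[ℝ] ℝ) (v w : V) :
    wedgeForm ![α, β] ![v, w] = α v * β w - α w * β v := by
  rw [wedgeForm_apply, Matrix.det_fin_two]
  simp

/-- The factor `1 / 2` compensates for the sum running over ordered pairs of indices. -/
theorem two_form_eq_sum (η : E4 [⋀^Fin 2]→L[ℝ] ℝ) :
    η = ∑ i, ∑ j, (1 / 2 * η ![EuclideanSpace.single i 1, EuclideanSpace.single j 1]) •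
      wedgeForm ![(EuclideanSpace.proj i : E4 →L[ℝ] ℝ), EuclideanSpace.proj j] := by
  apply ContinuousAlternatingMap.toAlternatingMap_injective
  refine Module.Basis.ext_alternating (EuclideanSpace.basisFun (Fin 4) ℝ).toBasis fun v _ ↦ ?_
  have e : ∀ f : E4 [⋀^Fin 2]→L[ℝ] ℝ, (f.toAlternatingMap fun i ↦
      (EuclideanSpace.basisFun (Fin 4) ℝ).toBasis (v i)) =
      f ![EuclideanSpace.single (v 0) 1, EuclideanSpace.single (v 1) 1] := fun f ↦ by
    refine congrArg f ?_
    ext1 i; fin_cases i <;> simp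
  rw [e, e]
  simp only [ContinuousAlternatingMap.sum_apply, ContinuousAlternatingMap.smul_apply,
    wedgeForm_two, smul_eq_mul]
  have hs : η ![EuclideanSpace.single (v 1) 1, EuclideanSpace.single (v 0) 1] =
      - η ![EuclideanSpace.single (v 0) 1, EuclideanSpace.single (v 1) 1] := by
    refine (congrArg η ?_).trans (η.toAlternatingMap.map_swap
      ![EuclideanSpace.single (v 0) 1, EuclideanSpace.single (v 1) 1]
      (show (0 : Fin 2) ≠ 1 by decide))
    ext1 i; fin_cases i <;> rfl
  simp [mul_sub, Finset.sum_sub_distrib, PiLp.single_apply, hs]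
  ring

variable {M : Type*} [TopologicalSpace M] [ChartedSpace E4 M] [IsManifold (𝓡 4) ∞ M]

theorem smoothFieldAt_coordVec {φ : OpenPartialHomeomorph M E4}
    (hφ : φ ∈ IsManifold.maximalAtlas (𝓡 4) ∞ M) {x : M} (hx : x ∈ φ.source) (i : Fin 4) :
    SmoothFieldAt (coordVec φ i) x := by
  refine ContMDiffAt.mpullback_vectorField_preimage (n := ∞) (I' := 𝓘(ℝ, E4)) (f := φ)
    (V := fun _ ↦ EuclideanSpace.single i (1 : ℝ)) ?_ (contMDiffAt_of_mem_maximalAtlas hφ hx)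
    (isInvertible_mfderiv_chart hφ hx) (by simp)
  exact contMDiffAt_vectorSpace_iff_contDiffAt.2 contDiffAt_const

theorem coordVec_chartAt_symm {x : M} {y : E4} (hy : y ∈ (extChartAt (𝓡 4) x).target)
    (i : Fin 4) :
    coordVec (chartAt E4 x) i ((extChartAt (𝓡 4) x).symm y) =
      mfderiv 𝓘(ℝ, E4) (𝓡 4) (extChartAt (𝓡 4) x).symm y (EuclideanSpace.single i (1 : ℝ)) := by
  have h := isInvertible_mfderiv_extChartAt ((extChartAt (𝓡 4) x).map_target hy)
  apply h.injective
  rw [mfderiv_comp_mfderiv_symm hy]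
  exact h.self_apply_inverse _

/-- The inverse chart sends the standard basis to the coordinate fields, so these functions are the
components of the pulled-back form. -/
theorem contDiffAt_chartPullback {η : FormField 2 M} {x : M}
    (h : ∀ i j, ContMDiffAt (𝓡 4) 𝓘(ℝ, ℝ) ∞
      (fun p ↦ η p ![coordVec (chartAt E4 x) i p, coordVec (chartAt E4 x) j p]) x) :
    ContDiffAt ℝ ∞ (chartPullback x η) (extChartAt (𝓡 4) x x) := by
  have h1 : ∀ i j, ContDiffAt ℝ ∞ (fun y ↦ chartPullback x η y
      ![EuclideanSpace.single i 1, EuclideanSpace.single j 1]) (extChartAt (𝓡 4) x x) := by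
    intro i j
    have h2 : ContMDiffAt 𝓘(ℝ, E4) (𝓡 4) ∞ (extChartAt (𝓡 4) x).symm (extChartAt (𝓡 4) x x) :=
      (contMDiffOn_extChartAt_symm x).contMDiffAt (mem_target_nhds x)
    have h3 := ContMDiffAt.comp_of_eq (h i j) h2 (extChartAt_to_inv x)
    refine h3.contDiffAt.congr_of_eventuallyEq ?_
    filter_upwards [mem_target_nhds x] with y hy
    simp only [Function.comp, coordVec_chartAt_symm hy]
    refine congrArg (η _) ?_
    ext1 k; fin_cases k <;> rfl
  have h4 : chartPullback x η = fun y ↦ ∑ i, ∑ j, (1 / 2 * chartPullback x η y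
      ![EuclideanSpace.single i 1, EuclideanSpace.single j 1]) •
      wedgeForm ![(EuclideanSpace.proj i : E4 →L[ℝ] ℝ), EuclideanSpace.proj j] :=
    funext fun y ↦ two_form_eq_sum _
  rw [h4]
  exact ContDiffAt.sum fun i _ ↦ ContDiffAt.sum fun j _ ↦
    (contDiffAt_const.mul (h1 i j)).smul contDiffAt_const

namespace LorentzMetric

variable {g : LorentzMetric M}

theorem contMDiffAt_pair {X Y : VField M} {x : M} (hX : SmoothFieldAt X x)
    (hY : SmoothFieldAt Y x) : ContMDiffAt (𝓡 4) 𝓘(ℝ, ℝ) ∞ (g.pair X Y) x := by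
  have : ContMDiffAt (𝓡 4) ((𝓡 4).prod 𝓘(ℝ, ℝ)) ∞
      (fun m ↦ TotalSpace.mk' ℝ (E := Bundle.Trivial M ℝ) m (g.val m (X m) (Y m))) x := by
    apply ContMDiffAt.clm_bundle_apply₂ (F₁ := E4) (F₂ := E4)
    · exact g.smooth x
    · exact hX
    · exact hY
  simp only [contMDiffAt_totalSpace] at this
  exact this.2

theorem contDiffAt_chartPullback_wedge {x : M} {w : M → ℝ} {X Y : VField M}
    (hw : ContMDiffAt (𝓡 4) 𝓘(ℝ, ℝ) ∞ w x) (hX : SmoothFieldAt X x) (hY : SmoothFieldAt Y x) :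
    ContDiffAt ℝ ∞ (chartPullback x fun p ↦ w p • wedgeForm ![g.val p (X p), g.val p (Y p)])
      (extChartAt (𝓡 4) x x) := by
  refine contDiffAt_chartPullback fun i j ↦ ?_
  have hc := smoothFieldAt_coordVec (IsManifold.chart_mem_maximalAtlas (I := 𝓡 4) (n := ∞) x)
    (mem_chart_source E4 x)
  simp only [ContinuousAlternatingMap.smul_apply, wedgeForm_two, smul_eq_mul]
  exact hw.mul (((contMDiffAt_pair hX (hc i)).mul (contMDiffAt_pair hY (hc j))).sub
    ((contMDiffAt_pair hX (hc j)).mul (contMDiffAt_pair hY (hc i))))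

end LorentzMetric

end SmoothForms

/-! ### The closed form `u dx² ∧ dx³` of an adapted chart -/

section Transverse

set_option linter.unusedSectionVars false

open Set Filter Topology

variable {M : Type*} [TopologicalSpace M] [ChartedSpace E4 M] [IsManifold (𝓡 4) ∞ M]

/-- Openness upgrades smoothness of `u` on this set to smoothness at each of its points. -/
theorem isOpen_image_transverse (φ : OpenPartialHomeomorph M E4) :
    IsOpen ((fun x ↦ (φ x 2, φ x 3)) '' φ.source) := by
  have h : IsOpenMap ((EuclideanSpace.proj 2 : E4 →L[ℝ] ℝ).prod
      (EuclideanSpace.proj 3 : E4 →L[ℝ] ℝ)) := by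
    refine ContinuousLinearMap.isOpenMap _ fun y ↦ ⟨!₂[0, 0, y.1, y.2], ?_⟩
    ext <;> simp
  have h2 := h _ (φ.image_source_eq_target ▸ φ.open_target : IsOpen (φ '' φ.source))
  rwa [image_image] at h2

theorem contMDiffAt_transverse {φ : OpenPartialHomeomorph M E4}
    (hφ : φ ∈ IsManifold.maximalAtlas (𝓡 4) ∞ M) {u : ℝ → ℝ → ℝ}
    (hu : ContDiffOn ℝ ∞ (fun y : ℝ × ℝ ↦ u y.1 y.2) ((fun x ↦ (φ x 2, φ x 3)) '' φ.source))
    {x : M} (hx : x ∈ φ.source) :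
    ContMDiffAt (𝓡 4) 𝓘(ℝ, ℝ) ∞ (fun p ↦ u (φ p 2) (φ p 3)) x := by
  have h1 := (hu.contDiffAt ((isOpen_image_transverse φ).mem_nhds (mem_image_of_mem _ hx)))
  have h2 : ContMDiffAt (𝓡 4) 𝓘(ℝ, E4) ∞ φ x := contMDiffAt_of_mem_maximalAtlas hφ hx
  have h3 := (((EuclideanSpace.proj 2 : E4 →L[ℝ] ℝ).prod
      (EuclideanSpace.proj 3 : E4 →L[ℝ] ℝ)).contDiff (n := ∞)).contMDiff.contMDiffAt.comp x h2
  exact h1.contMDiffAt.comp x h3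

/-- The form `u dx² ∧ dx³`, where `u` is evaluated on the last two coordinates of the chart. -/
def transverseForm (φ : OpenPartialHomeomorph M E4) (u : ℝ → ℝ → ℝ) : FormField 2 M := fun x ↦
  u (φ x 2) (φ x 3) • wedgeForm ![coordForm φ 2 x, coordForm φ 3 x]

theorem isSmoothFormOn_transverseForm {φ : OpenPartialHomeomorph M E4}
    (hφ : φ ∈ IsManifold.maximalAtlas (𝓡 4) ∞ M) {u : ℝ → ℝ → ℝ}
    (hu : ContDiffOn ℝ ∞ (fun y : ℝ × ℝ ↦ u y.1 y.2) ((fun x ↦ (φ x 2, φ x 3)) '' φ.source)) :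
    IsSmoothFormOn (transverseForm φ u) φ.source := by
  intro x hx
  refine contDiffAt_chartPullback fun i j ↦ ?_
  have hc := smoothFieldAt_coordVec (IsManifold.chart_mem_maximalAtlas (I := 𝓡 4) (n := ∞) x)
    (mem_chart_source E4 x)
  have hf := fun i k ↦ contMDiffAt_coordForm hφ hx (hc i) k
  simp only [transverseForm, ContinuousAlternatingMap.smul_apply, wedgeForm_two, smul_eq_mul]
  exact (contMDiffAt_transverse hφ hu hx).mul (((hf i 2).mul (hf j 3)).sub ((hf j 2).mul (hf i 3)))

/-- The differential of `u` is a combination of the two covectors already present in the wedge. -/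
theorem extDeriv_smul_wedge_proj {u : ℝ → ℝ → ℝ} {z : E4}
    (hu : DifferentiableAt ℝ (fun y : ℝ × ℝ ↦ u y.1 y.2) (z 2, z 3)) :
    extDeriv (fun y : E4 ↦ u (y 2) (y 3) •
      wedgeForm ![(EuclideanSpace.proj 2 : E4 →L[ℝ] ℝ), EuclideanSpace.proj 3]) z = 0 := by
  set P := (EuclideanSpace.proj 2 : E4 →L[ℝ] ℝ).prod (EuclideanSpace.proj 3 : E4 →L[ℝ] ℝ) with hP
  set L := (fderiv ℝ (fun y : ℝ × ℝ ↦ u y.1 y.2) (z 2, z 3)) with hL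
  have hU : HasFDerivAt (fun y : E4 ↦ u (y 2) (y 3)) (L.comp P) z :=
    HasFDerivAt.comp z (f := P) (g := fun y : ℝ × ℝ ↦ u y.1 y.2) hu.hasFDerivAt P.hasFDerivAt
  refine ContinuousAlternatingMap.ext fun (v : Fin (2 + 1) → E4) ↦ ?_
  refine (extDeriv_apply (n := 2) (hU.differentiableAt.smul_const _) v).trans ?_
  have hd : ∀ c : ℝ, fderiv ℝ (fun y : E4 ↦ u (y 2) (y 3) * c) z = c • L.comp P :=
    fun c ↦ (hU.mul_const c).fderiv
  have hLP : ∀ w : E4, L (P w) = w 2 * L (1, 0) + w 3 * L (0, 1) := by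
    intro w
    have : P w = w 2 • ((1 : ℝ), (0 : ℝ)) + w 3 • ((0 : ℝ), (1 : ℝ)) := by ext <;> simp [hP]
    rw [this, map_add, map_smul, map_smul]; rfl
  have e0 : ∀ (V : Fin 3 → E4), Fin.removeNth 0 V = ![V 1, V 2] := fun V ↦ by
    ext1 i; fin_cases i <;> rfl
  have e1 : ∀ (V : Fin 3 → E4), Fin.removeNth 1 V = ![V 0, V 2] := fun V ↦ by
    ext1 i; fin_cases i <;> rfl
  have e2 : ∀ (V : Fin 3 → E4), Fin.removeNth 2 V = ![V 0, V 1] := fun V ↦ by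
    ext1 i; fin_cases i <;> rfl
  simp only [ContinuousAlternatingMap.smul_apply, smul_eq_mul, hd, _root_.smul_apply,
    ContinuousLinearMap.comp_apply, hLP]
  simp [Fin.sum_univ_succ, e0, e1, e2, wedgeForm_two]
  ring

/-- In the preferred chart the form is the pull-back, by the transition map `f` to `φ`, of a closed
form on the model space, and `d` commutes with pull-back. -/
theorem extD_transverseForm {φ : OpenPartialHomeomorph M E4}
    (hφ : φ ∈ IsManifold.maximalAtlas (𝓡 4) ∞ M) {u : ℝ → ℝ → ℝ}
    (hu : ContDiffOn ℝ ∞ (fun y : ℝ × ℝ ↦ u y.1 y.2) ((fun x ↦ (φ x 2, φ x 3)) '' φ.source))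
    {x : M} (hx : x ∈ φ.source) : extD (transverseForm φ u) x = 0 := by
  set f : E4 → E4 := fun y ↦ φ ((extChartAt (𝓡 4) x).symm y) with hf
  have h2 : ContMDiffAt 𝓘(ℝ, E4) (𝓡 4) ∞ (extChartAt (𝓡 4) x).symm (extChartAt (𝓡 4) x x) :=
    (contMDiffOn_extChartAt_symm x).contMDiffAt (mem_target_nhds x)
  have hφx : ContMDiffAt (𝓡 4) 𝓘(ℝ, E4) ∞ φ x := contMDiffAt_of_mem_maximalAtlas hφ hx
  have hfs : ContDiffAt ℝ ∞ f (extChartAt (𝓡 4) x x) :=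
    (hφx.comp_of_eq h2 (extChartAt_to_inv x)).contDiffAt
  have hfx : f (extChartAt (𝓡 4) x x) = φ x := by rw [hf]; exact congrArg φ (extChartAt_to_inv x)
  have hux : DifferentiableAt ℝ (fun y : ℝ × ℝ ↦ u y.1 y.2) (φ x 2, φ x 3) :=
    (hu.contDiffAt ((isOpen_image_transverse φ).mem_nhds
      (mem_image_of_mem _ hx))).differentiableAt (by simp)
  have hev : chartPullback x (transverseForm φ u) =ᶠ[𝓝 (extChartAt (𝓡 4) x x)] fun y ↦
      (u (f y 2) (f y 3) • wedgeForm ![(EuclideanSpace.proj 2 : E4 →L[ℝ] ℝ),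
        EuclideanSpace.proj 3]).compContinuousLinearMap (fderiv ℝ f y) := by
    have hsrc : (extChartAt (𝓡 4) x).symm ⁻¹' φ.source ∈ 𝓝 (extChartAt (𝓡 4) x x) := by
      refine h2.continuousAt.preimage_mem_nhds ?_
      rw [extChartAt_to_inv]
      exact φ.open_source.mem_nhds hx
    filter_upwards [mem_target_nhds x, hsrc] with y hy hys
    have h4 : MDifferentiableAt 𝓘(ℝ, E4) (𝓡 4) (extChartAt (𝓡 4) x).symm y :=
      ((contMDiffOn_extChartAt_symm (n := 1) x).contMDiffAt
        ((isOpen_extChartAt_target x).mem_nhds hy)).mdifferentiableAt (by simp)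
    have h5 : MDifferentiableAt (𝓡 4) 𝓘(ℝ, E4) φ ((extChartAt (𝓡 4) x).symm y) :=
      (contMDiffAt_of_mem_maximalAtlas hφ hys).mdifferentiableAt (by simp)
    have h6 := mfderiv_comp y h5 h4
    have h7 : ∀ v : E4, fderiv ℝ f y v = mfderiv (𝓡 4) 𝓘(ℝ, E4) φ ((extChartAt (𝓡 4) x).symm y)
        (mfderiv 𝓘(ℝ, E4) (𝓡 4) (extChartAt (𝓡 4) x).symm y v) := fun v ↦ by
      rw [← mfderiv_eq_fderiv]
      exact congrArg (fun k ↦ k v) h6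
    ext v
    refine congrArg (u (f y 2) (f y 3) * ·) ?_
    refine (wedgeForm_apply _ _).trans (Eq.trans ?_ (wedgeForm_apply _ _).symm)
    refine congrArg Matrix.det (Matrix.ext fun i j ↦ ?_)
    fin_cases i
    · exact congrArg (fun w : E4 ↦ w 2) (h7 (v j)).symm
    · exact congrArg (fun w : E4 ↦ w 3) (h7 (v j)).symm
  set Ω : E4 → E4 [⋀^Fin 2]→L[ℝ] ℝ := fun y ↦ u (y 2) (y 3) •
    wedgeForm ![(EuclideanSpace.proj 2 : E4 →L[ℝ] ℝ), EuclideanSpace.proj 3] with hΩ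
  have hdΩ : DifferentiableAt ℝ Ω (φ x) := by
    refine DifferentiableAt.smul_const ?_ _
    exact DifferentiableAt.comp (φ x) (f := (EuclideanSpace.proj 2 : E4 →L[ℝ] ℝ).prod
      (EuclideanSpace.proj 3 : E4 →L[ℝ] ℝ)) (g := fun y : ℝ × ℝ ↦ u y.1 y.2) hux
      (ContinuousLinearMap.differentiableAt _)
  have key := extDeriv_pullback (hfx ▸ hdΩ) hfs (by simpa using ENat.LEInfty.out)
  simp only [extD]
  rw [hev.extDeriv_eq, key, hfx, extDeriv_smul_wedge_proj hux]
  rfl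

end Transverse

/-! ### Algebra of null tetrads: contractions and the Hodge star -/

section Tetrad

set_option linter.unusedSectionVars false

variable {M : Type*} [TopologicalSpace M] [ChartedSpace E4 M] [IsManifold (𝓡 4) ∞ M]

namespace LorentzMetric

variable {g : LorentzMetric M} {D : PlaneField M} {x : M} {s l a n : TangentSpace (𝓡 4) x}

theorem lorentzSign_mul_self (i : Fin 4) : lorentzSign i * lorentzSign i = 1 := by
  unfold lorentzSign; split_ifs <;> norm_num

theorem IsAdaptedTetrad.expand (h : g.IsAdaptedTetrad D x s l a n) (v : TangentSpace (𝓡 4) x) :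
    v = -g.val x v n • l - g.val x v l • n + g.val x v s • s + g.val x v a • a := by
  have hsl := h.ls ▸ g.symm x s l
  have hal := h.la ▸ g.symm x a l
  have has := h.sa ▸ g.symm x a s
  have hns := h.sn ▸ g.symm x n s
  have hna := h.an ▸ g.symm x n a
  have hnl := h.ln ▸ g.symm x n l
  -- Pairing a linear relation with `s`, `n`, `a`, `l` isolates its coefficients one by one, up to
  -- sign. Four independent vectors span, so the expansion need only be checked against the tetrad.
  have hli : LinearIndependent ℝ ![s, l, a, n] := by
    rw [Fintype.linearIndependent_iff]
    intro c hc
    simp only [Fin.sum_univ_four, Matrix.cons_val] at hc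
    have key : ∀ w, g.val x (c 0 • s + c 1 • l + c 2 • a + c 3 • n) w = 0 := fun w ↦ by
      rw [hc]; simp
    have h0 := key s
    have h1 := key n
    have h2 := key a
    have h3 := key l
    simp [h.ss, h.aa, h.ll, h.nn, h.ln, h.ls, h.la, h.sa, h.sn, h.an, hsl, hal, has, hns, hna,
      hnl] at h0 h1 h2 h3
    intro i
    fin_cases i <;> assumption
  have hspan : Submodule.span ℝ (Set.range ![s, l, a, n]) = ⊤ :=
    hli.span_eq_top_of_card_eq_finrank' (by
      exact (Fintype.card_fin 4).trans (finrank_euclideanSpace_fin (𝕜 := ℝ) (n := 4)).symm)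
  rw [← sub_eq_zero]
  refine g.nondegenerate x _ fun w ↦ ?_
  have hw : w ∈ Submodule.span ℝ (Set.range ![s, l, a, n]) := hspan ▸ Submodule.mem_top
  induction hw using Submodule.span_induction with
  | mem w hw =>
    obtain ⟨i, rfl⟩ := hw
    fin_cases i <;>
    simp [h.ss, h.aa, h.ll, h.nn, h.ln, h.ls, h.la, h.sa, h.sn, h.an, hsl, hal, has, hns, hna, hnl]
  | zero => simp
  | add u w _ _ hu hw => rw [map_add, hu, hw, add_zero]
  | smul c w _ hw => rw [map_smul, hw, smul_zero]

variable (g) in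
theorem val_basis (x : M) (i j : Fin 4) :
    g.val x (g.basis x i) (g.basis x j) = if i = j then lorentzSign i else 0 :=
  Classical.choose_spec (g.signature x) i j

variable (g) in
theorem sum_val_basis_smul (x : M) (v : TangentSpace (𝓡 4) x) :
    ∑ i, (lorentzSign i * g.val x v (g.basis x i)) • g.basis x i = v := by
  rw [← sub_eq_zero]
  refine g.nondegenerate x _ fun w ↦ ?_
  have : g.val x (∑ i, (lorentzSign i * g.val x v (g.basis x i)) • g.basis x i - v) = 0 := by
    apply ContinuousLinearMap.coe_injective
    refine (g.basis x).ext fun j ↦ ?_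
    simp [val_basis, Finset.sum_apply]
    rw [mul_right_comm, lorentzSign_mul_self, one_mul, sub_self]
  rw [this]; rfl

theorem sum_lorentzSign_mul (P : TangentSpace (𝓡 4) x →ₗ[ℝ] ℝ) (v : TangentSpace (𝓡 4) x) :
    ∑ i, lorentzSign i * g.val x v (g.basis x i) * P (g.basis x i) = P v := by
  conv_rhs => rw [← g.sum_val_basis_smul x v]
  simp

theorem sum_lorentzSign_val_mul_val (v w : TangentSpace (𝓡 4) x) :
    ∑ i, lorentzSign i * g.val x v (g.basis x i) * g.val x w (g.basis x i) = g.val x v w :=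
  sum_lorentzSign_mul (g.val x w).toLinearMap v |>.trans (g.symm x _ _)

/-- Both sides contract `P ⊗ Q` with the inverse metric, which in the tetrad reads `s⊗s + a⊗a - l⊗n
- n⊗l`; hence the signs and the transposition of `l` and `n`. -/
theorem IsAdaptedTetrad.sum_basis (h : g.IsAdaptedTetrad D x s l a n)
    (P Q : TangentSpace (𝓡 4) x →ₗ[ℝ] ℝ) :
    ∑ i, lorentzSign i * (P (g.basis x i) * Q (g.basis x i)) =
      ∑ m, (![1, 1, -1, -1] : Fin 4 → ℝ) m *
        (P (![s, a, l, n] m) * Q (![s, a, l, n] (Equiv.swap 2 3 m))) := by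
  have e : ∀ i, Q (g.basis x i) = -g.val x n (g.basis x i) * Q l - g.val x l (g.basis x i) * Q n
      + g.val x s (g.basis x i) * Q s + g.val x a (g.basis x i) * Q a := fun i ↦ by
    conv_lhs => rw [h.expand (g.basis x i)]
    simp [g.symm x (g.basis x i)]
  have h1 : ∀ i, lorentzSign i * (P (g.basis x i) * Q (g.basis x i)) =
      -(lorentzSign i * g.val x n (g.basis x i) * P (g.basis x i)) * Q l
      - (lorentzSign i * g.val x l (g.basis x i) * P (g.basis x i)) * Q n
      + (lorentzSign i * g.val x s (g.basis x i) * P (g.basis x i)) * Q s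
      + (lorentzSign i * g.val x a (g.basis x i) * P (g.basis x i)) * Q a := fun i ↦ by
    rw [e]; ring
  simp only [h1, Finset.sum_add_distrib, Finset.sum_sub_distrib, ← Finset.sum_mul,
    Finset.sum_neg_distrib, sum_lorentzSign_mul]
  have s2 : (Equiv.swap 2 3 : Equiv.Perm (Fin 4)) 2 = 3 := by decide
  have s3 : (Equiv.swap 2 3 : Equiv.Perm (Fin 4)) 3 = 2 := by decide
  have s0 : (Equiv.swap 2 3 : Equiv.Perm (Fin 4)) 0 = 0 := by decide
  have s1 : (Equiv.swap 2 3 : Equiv.Perm (Fin 4)) 1 = 1 := by decide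
  simp only [Fin.sum_univ_four, s0, s1, s2, s3, Matrix.cons_val]
  ring

theorem formSq_wedge {F : FormField 2 M} {c : ℝ} {v w : TangentSpace (𝓡 4) x}
    (hF : F x = c • wedgeForm ![g.val x v, g.val x w]) :
    g.formSq F x = 2 * c ^ 2 * (g.val x v v * g.val x w w - g.val x v w ^ 2) := by
  have h : ∀ i j, lorentzSign i * lorentzSign j * F x ![g.basis x i, g.basis x j] ^ 2 =
      c ^ 2 * ((lorentzSign i * g.val x v (g.basis x i) * g.val x v (g.basis x i)) *
        (lorentzSign j * g.val x w (g.basis x j) * g.val x w (g.basis x j)))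
      + c ^ 2 * ((lorentzSign i * g.val x w (g.basis x i) * g.val x w (g.basis x i)) *
        (lorentzSign j * g.val x v (g.basis x j) * g.val x v (g.basis x j)))
      - 2 * c ^ 2 * ((lorentzSign i * g.val x v (g.basis x i) * g.val x w (g.basis x i)) *
        (lorentzSign j * g.val x v (g.basis x j) * g.val x w (g.basis x j))) := fun i j ↦ by
    rw [hF, ContinuousAlternatingMap.smul_apply, wedgeForm_two, smul_eq_mul]
    ring
  simp only [formSq, h, Finset.sum_add_distrib, Finset.sum_sub_distrib, ← Finset.mul_sum,
    ← Finset.sum_mul, sum_lorentzSign_val_mul_val]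
  ring

/-- A form as a linear function of its `i`-th argument. -/
def slot {k : ℕ} (η : TangentSpace (𝓡 4) x [⋀^Fin k]→L[ℝ] ℝ) (m : Fin k → TangentSpace (𝓡 4) x)
    (i : Fin k) : TangentSpace (𝓡 4) x →ₗ[ℝ] ℝ :=
  η.toAlternatingMap.toMultilinearMap.toLinearMap m i

/-- Raising both indices of `p♭ ∧ q♭` gives `p ∧ q`; its two terms contribute equally to the
contraction with `vol`, which absorbs the `1 / 2`. -/
theorem hodge₂_wedge (vol : FormField 4 M) {F : FormField 2 M} {c : ℝ}
    {p q : TangentSpace (𝓡 4) x} (hF : F x = c • wedgeForm ![g.val x p, g.val x q])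
    (v w : TangentSpace (𝓡 4) x) :
    g.hodge₂ vol F x ![v, w] = c * vol x ![p, q, v, w] := by
  have h0 : ∀ u r, slot (vol x) ![0, r, v, w] 0 u = vol x ![u, r, v, w] := fun u r ↦
    congrArg (vol x) (by ext1 i; fin_cases i <;> rfl)
  have h1 : ∀ u r, slot (vol x) ![r, 0, v, w] 1 u = vol x ![r, u, v, w] := fun u r ↦
    congrArg (vol x) (by ext1 i; fin_cases i <;> rfl)
  have hT : ∀ p q, ∑ i, ∑ j, lorentzSign i * g.val x p (g.basis x i) *
      (lorentzSign j * g.val x q (g.basis x j) * vol x ![g.basis x i, g.basis x j, v, w]) =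
      vol x ![p, q, v, w] := fun p q ↦ by
    simp only [← Finset.mul_sum, ← h1, sum_lorentzSign_mul]
    simp only [h1, ← h0 _ q, sum_lorentzSign_mul]
  have hcT : ∀ p q, ∑ i, ∑ j, c * (lorentzSign i * g.val x p (g.basis x i) *
      (lorentzSign j * g.val x q (g.basis x j) * vol x ![g.basis x i, g.basis x j, v, w])) =
      c * vol x ![p, q, v, w] := fun p q ↦ by
    rw [← hT]
    simp only [Finset.mul_sum]
  have hanti : vol x ![q, p, v, w] = -vol x ![p, q, v, w] :=
    (congrArg (vol x) (by ext1 i; fin_cases i <;> rfl)).trans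
      ((vol x).toAlternatingMap.map_swap ![p, q, v, w] (show (0 : Fin 4) ≠ 1 by decide))
  have h2 : ∀ i j, lorentzSign i * lorentzSign j * F x ![g.basis x i, g.basis x j] *
      vol x ![g.basis x i, g.basis x j, v, w] =
      c * (lorentzSign i * g.val x p (g.basis x i) *
        (lorentzSign j * g.val x q (g.basis x j) * vol x ![g.basis x i, g.basis x j, v, w]))
      - c * (lorentzSign i * g.val x q (g.basis x i) *
        (lorentzSign j * g.val x p (g.basis x j) * vol x ![g.basis x i, g.basis x j, v, w])) :=
    fun i j ↦ by
      rw [hF, ContinuousAlternatingMap.smul_apply, wedgeForm_two, smul_eq_mul]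
      ring
  have h3 : g.hodge₂ vol F x ![v, w] = 1 / 2 * ∑ i, ∑ j, lorentzSign i * lorentzSign j *
      F x ![g.basis x i, g.basis x j] * vol x ![g.basis x i, g.basis x j, v, w] := by
    simp [hodge₂, ContinuousAlternatingMap.sum_apply, intProd_apply]
  rw [h3]
  simp only [h2, Finset.sum_sub_distrib, hcT, hanti]
  ring

/-- A finite check for the next lemma: either the volume form meets a repeated vector, or `m, n, p`
are exactly the indices other than the metric dual of `q`. -/
theorem succAbove_or_repeated (m n p q : Fin 4) :
    (∃ ρ : Equiv.Perm (Fin 3), ∀ i, ![m, n, p] i = (Equiv.swap 2 3 q).succAbove (ρ i)) ∨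
    (∃ i j : Fin 4, ![Equiv.swap 2 3 m, Equiv.swap 2 3 n, Equiv.swap 2 3 p, q] i =
      ![Equiv.swap 2 3 m, Equiv.swap 2 3 n, Equiv.swap 2 3 p, q] j ∧ i ≠ j) := by
  revert m n p q
  decide

/-- Rewritten in the tetrad, the contraction pairs `J` on a triple with `vol` on the dual triple and
the `q`-th vector. By alternation only the permutations of a single triple survive, the one that
omits the metric dual of the `q`-th vector, and there `J` vanishes. -/
theorem IsAdaptedTetrad.contract_eq_zero (h : g.IsAdaptedTetrad D x s l a n)
    (J : TangentSpace (𝓡 4) x [⋀^Fin 3]→L[ℝ] ℝ) (vol : TangentSpace (𝓡 4) x [⋀^Fin 4]→L[ℝ] ℝ)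
    (q : Fin 4) (hJ : J (fun i ↦ ![s, a, l, n] ((Equiv.swap 2 3 q).succAbove i)) = 0) :
    ∑ i, ∑ j, ∑ k, lorentzSign i * lorentzSign j * lorentzSign k *
      J ![g.basis x i, g.basis x j, g.basis x k] *
      vol ![g.basis x i, g.basis x j, g.basis x k, ![s, a, l, n] q] = 0 := by
  have hsum := h.sum_basis
  set f := ![s, a, l, n] with hf
  set η : Fin 4 → ℝ := ![1, 1, -1, -1]
  have hterm : ∀ m n p, J ![f m, f n, f p] *
      vol ![f (Equiv.swap 2 3 m), f (Equiv.swap 2 3 n), f (Equiv.swap 2 3 p), f q] = 0 := by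
    intro m n p
    rcases succAbove_or_repeated m n p q with ⟨ρ, hρ⟩ | ⟨i, j, hij, hne⟩
    · have h1 : J ![f m, f n, f p] =
          J ((fun i ↦ f ((Equiv.swap 2 3 q).succAbove i)) ∘ ρ) := by
        congr 1
        ext1 i
        simp only [Function.comp, ← hρ]
        fin_cases i <;> rfl
      have h2 := J.toAlternatingMap.map_perm (fun i ↦ f ((Equiv.swap 2 3 q).succAbove i)) ρ
      have h3 : J ((fun i ↦ f ((Equiv.swap 2 3 q).succAbove i)) ∘ ρ) = 0 :=
        h2.trans ((congrArg _ hJ).trans (smul_zero _))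
      rw [h1, h3, zero_mul]
    · have h1 : ![f (Equiv.swap 2 3 m), f (Equiv.swap 2 3 n), f (Equiv.swap 2 3 p), f q] =
          fun i ↦ f (![Equiv.swap 2 3 m, Equiv.swap 2 3 n, Equiv.swap 2 3 p, q] i) := by
        ext1 i; fin_cases i <;> rfl
      rw [h1, vol.map_eq_zero_of_eq (fun i ↦ f (![Equiv.swap 2 3 m, Equiv.swap 2 3 n,
        Equiv.swap 2 3 p, q] i)) (congrArg f hij) hne, mul_zero]
  have hk : ∀ b c b' c', ∑ k, lorentzSign k * (J ![b, c, g.basis x k] *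
      vol ![b', c', g.basis x k, f q]) =
      ∑ p, η p * (J ![b, c, f p] * vol ![b', c', f (Equiv.swap 2 3 p), f q]) := by
    intro b c b' c'
    have e1 : ∀ v, slot J ![b, c, 0] 2 v = J ![b, c, v] := fun v ↦
      congrArg J (by ext1 i; fin_cases i <;> rfl)
    have e2 : ∀ v, slot vol ![b', c', 0, f q] 2 v = vol ![b', c', v, f q] := fun v ↦
      congrArg vol (by ext1 i; fin_cases i <;> rfl)
    simp only [← e1, ← e2, hsum]
  have hj : ∀ b c b' c', ∑ k, lorentzSign k * (J ![b, g.basis x k, c] *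
      vol ![b', g.basis x k, c', f q]) =
      ∑ p, η p * (J ![b, f p, c] * vol ![b', f (Equiv.swap 2 3 p), c', f q]) := by
    intro b c b' c'
    have e1 : ∀ v, slot J ![b, 0, c] 1 v = J ![b, v, c] := fun v ↦
      congrArg J (by ext1 i; fin_cases i <;> rfl)
    have e2 : ∀ v, slot vol ![b', 0, c', f q] 1 v = vol ![b', v, c', f q] := fun v ↦
      congrArg vol (by ext1 i; fin_cases i <;> rfl)
    simp only [← e1, ← e2, hsum]
  have hi : ∀ b c b' c', ∑ k, lorentzSign k * (J ![g.basis x k, b, c] *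
      vol ![g.basis x k, b', c', f q]) =
      ∑ p, η p * (J ![f p, b, c] * vol ![f (Equiv.swap 2 3 p), b', c', f q]) := by
    intro b c b' c'
    have e1 : ∀ v, slot J ![0, b, c] 0 v = J ![v, b, c] := fun v ↦
      congrArg J (by ext1 i; fin_cases i <;> rfl)
    have e2 : ∀ v, slot vol ![0, b', c', f q] 0 v = vol ![v, b', c', f q] := fun v ↦
      congrArg vol (by ext1 i; fin_cases i <;> rfl)
    simp only [← e1, ← e2, hsum]
  calc _ = ∑ i, lorentzSign i * ∑ j, lorentzSign j * ∑ k, lorentzSign k *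
        (J ![g.basis x i, g.basis x j, g.basis x k] *
          vol ![g.basis x i, g.basis x j, g.basis x k, f q]) := by
        simp only [Finset.mul_sum, mul_assoc]
    _ = ∑ p, η p * ∑ i, lorentzSign i * ∑ j, lorentzSign j *
        (J ![g.basis x i, g.basis x j, f p] *
          vol ![g.basis x i, g.basis x j, f (Equiv.swap 2 3 p), f q]) := by
        simp only [hk, Finset.mul_sum]
        rw [Finset.sum_congr rfl fun i _ ↦ Finset.sum_comm, Finset.sum_comm]
        refine Finset.sum_congr rfl fun p _ ↦ Finset.sum_congr rfl fun i _ ↦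
          Finset.sum_congr rfl fun j _ ↦ by ring
    _ = ∑ p, η p * ∑ m, η m * ∑ i, lorentzSign i *
        (J ![g.basis x i, f m, f p] *
          vol ![g.basis x i, f (Equiv.swap 2 3 m), f (Equiv.swap 2 3 p), f q]) := by
        refine Finset.sum_congr rfl fun p _ ↦ congrArg _ ?_
        simp only [hj, Finset.mul_sum]
        rw [Finset.sum_comm]
        refine Finset.sum_congr rfl fun p _ ↦ Finset.sum_congr rfl fun i _ ↦ by ring
    _ = 0 := by simp only [hi, hterm, mul_zero, Finset.sum_const_zero]

/-- The annihilator of `span{l, a}` is spanned by `s♭` and `l♭`, so one coefficient remains, found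
by evaluating on `(s, n)`. -/
theorem IsAdaptedTetrad.two_form_eq (h : g.IsAdaptedTetrad D x s l a n)
    (β : TangentSpace (𝓡 4) x [⋀^Fin 2]→L[ℝ] ℝ) (hl : ∀ v, β ![l, v] = 0)
    (ha : ∀ v, β ![a, v] = 0) :
    β = (-β ![s, n]) • wedgeForm ![g.val x s, g.val x l] := by
  have e1 : ∀ u v, slot β ![v, 0] 1 u = β ![v, u] := fun u v ↦
    congrArg β (by ext1 i; fin_cases i <;> rfl)
  have anti : ∀ u v, β ![u, v] = -β ![v, u] := fun u v ↦
    (congrArg β (by ext1 i; fin_cases i <;> rfl)).trans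
      (β.toAlternatingMap.map_swap ![v, u] (show (0 : Fin 2) ≠ 1 by decide))
  have self : ∀ u, β ![u, u] = 0 := fun u ↦ by linarith [anti u u]
  have hl' : ∀ v, β ![v, l] = 0 := fun v ↦ by rw [anti, hl, neg_zero]
  have ha' : ∀ v, β ![v, a] = 0 := fun v ↦ by rw [anti, ha, neg_zero]
  ext v
  have hv : v = ![v 0, v 1] := by ext1 i; fin_cases i <;> rfl
  rw [hv]
  have step : ∀ u w, β ![u, w] = -g.val x w l * β ![u, n] + g.val x w s * β ![u, s] := fun u w ↦ by
    have hw := congrArg (slot β ![u, 0] 1) (h.expand w)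
    simp only [map_add, map_sub, map_smul, smul_eq_mul] at hw
    simp only [e1, hl', ha'] at hw
    linarith
  rw [ContinuousAlternatingMap.smul_apply, wedgeForm_two, step, anti _ n, anti _ s, step n, step s,
    self, self, anti n s, g.symm x s, g.symm x s, g.symm x l, g.symm x l, smul_eq_mul]
  ring

theorem hodge₃_apply (vol : FormField 4 M) (J : FormField 3 M) (v : TangentSpace (𝓡 4) x) :
    g.hodge₃ vol J x ![v] = 1 / 6 * ∑ i, ∑ j, ∑ k, lorentzSign i * lorentzSign j * lorentzSign k *
      J x ![g.basis x i, g.basis x j, g.basis x k] *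
      vol x ![g.basis x i, g.basis x j, g.basis x k, v] := by
  simp [hodge₃, ContinuousAlternatingMap.sum_apply, intProd_apply]

theorem IsAdaptedTetrad.hodge₂_eq (h : g.IsAdaptedTetrad D x s l a n) (vol : FormField 4 M)
    {F : FormField 2 M} {c : ℝ} (hF : F x = c • wedgeForm ![g.val x a, g.val x l]) :
    g.hodge₂ vol F x = (-(c * vol x ![a, l, s, n])) • wedgeForm ![g.val x s, g.val x l] := by
  have hval := hodge₂_wedge vol hF
  rw [← hval]
  refine h.two_form_eq _ (fun v ↦ ?_) fun v ↦ ?_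
  · rw [hval, (vol x).map_eq_zero_of_eq _ (i := 1) (j := 2) rfl (by decide), mul_zero]
  · rw [hval, (vol x).map_eq_zero_of_eq _ (i := 0) (j := 2) rfl (by decide), mul_zero]

/-- The force-free condition follows from the vanishing of `d*F` on two triples of the tetrad. -/
theorem IsAdaptedTetrad.intProd_currentVec (h : g.IsAdaptedTetrad D x s l a n)
    {F : FormField 2 M} {c : ℝ} (hF : F x = c • wedgeForm ![g.val x a, g.val x l])
    (h1 : extD (g.hodge₂ (g.volForm x) F) x ![l, s, a] = 0)
    (h2 : extD (g.hodge₂ (g.volForm x) F) x ![l, s, n] = 0) :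
    intProd (g.currentVec F x) (F x) = 0 := by
  have hj : ∀ v, g.val x (g.currentVec F x) v = g.current F x ![v] := fun v ↦ by
    rw [currentVec, val_sharp]
    exact congrArg (g.current F x) (by ext1 i; fin_cases i; rfl)
  have hz : ∀ q : Fin 4, extD (g.hodge₂ (g.volForm x) F) x
      (fun i ↦ ![s, a, l, n] ((Equiv.swap 2 3 q).succAbove i)) = 0 →
      g.val x (g.currentVec F x) (![s, a, l, n] q) = 0 := fun q hq ↦ by
    rw [hj, current, hodge₃_apply, h.contract_eq_zero _ _ q hq, mul_zero]
  have hperm : ∀ (J : TangentSpace (𝓡 4) x [⋀^Fin 3]→L[ℝ] ℝ) (ρ : Equiv.Perm (Fin 3)) {v},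
      J v = 0 → J (v ∘ ρ) = 0 := fun J ρ v hv ↦
    (J.toAlternatingMap.map_perm v ρ).trans ((congrArg _ hv).trans (smul_zero _))
  -- The dual of `l` is `n`, so the relevant triple is `s, a, l`; `a` is its own dual, so for it the
  -- triple is `s, l, n`.
  have hl : g.val x (g.currentVec F x) l = 0 := hz 2 (by
    rw [← hperm _ (finRotate 3) h1]; exact congrArg _ (by ext1 i; fin_cases i <;> rfl))
  have ha : g.val x (g.currentVec F x) a = 0 := hz 1 (by
    rw [← hperm _ (Equiv.swap 0 1) h2]; exact congrArg _ (by ext1 i; fin_cases i <;> rfl))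
  ext v
  rw [intProd_apply]
  have hv : Matrix.vecCons (g.currentVec F x) v = ![g.currentVec F x, v 0] := by
    ext1 i; fin_cases i <;> rfl
  rw [hv, hF, ContinuousAlternatingMap.smul_apply, wedgeForm_two, g.symm x a (g.currentVec F x),
    g.symm x l (g.currentVec F x), hl, ha]
  simp

end LorentzMetric

end Tetrad

/-! ### The force-free condition from equal expansions -/

section ForceFree

set_option linter.unusedSectionVars false

open Set Filter Topology

variable {M : Type*} [TopologicalSpace M] [ChartedSpace E4 M] [IsManifold (𝓡 4) ∞ M]

theorem extD_congr {k : ℕ} {η η' : FormField k M} {x : M} (h : ∀ᶠ p in 𝓝 x, η p = η' p) :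
    extD η x = extD η' x := by
  have hc : Tendsto (extChartAt (𝓡 4) x).symm (𝓝 (extChartAt (𝓡 4) x x)) (𝓝 x) := by
    have := continuousAt_extChartAt_symm (I := 𝓡 4) x
    rwa [ContinuousAt, extChartAt_to_inv] at this
  have h1 : chartPullback x η =ᶠ[𝓝 (extChartAt (𝓡 4) x x)] chartPullback x η' := by
    filter_upwards [hc.eventually h] with y hy
    simp only [chartPullback, hy]
  simp only [extD, h1.extDeriv_eq]

namespace LorentzMetric

variable {g : LorentzMetric M} {D : PlaneField M} {s l a n : VField M}

/-- The Gram matrix `Eᵀ G E` of the frame is constant with determinant `-1`, so the volume `√|det G|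
det E` has absolute value 1. The sign of the continuous, nonvanishing `det E` is locally constant.
-/
theorem IsAdaptedFrame.exists_volForm_eventually_eq (h : g.IsAdaptedFrame D s l a n) (x : M) :
    ∃ σ : ℝ, ∀ᶠ p in 𝓝 x, g.volForm x p ![a p, l p, s p, n p] = σ := by
  set φ := chartAt E4 x with hφ
  have hatlas : φ ∈ IsManifold.maximalAtlas (𝓡 4) ∞ M := IsManifold.chart_mem_maximalAtlas x
  have hx : x ∈ φ.source := mem_chart_source E4 x
  set f : ∀ p, Fin 4 → TangentSpace (𝓡 4) p := fun p ↦ ![a p, l p, s p, n p] with hf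
  set E : M → Matrix (Fin 4) (Fin 4) ℝ := fun p ↦ Matrix.of fun i j ↦ coordForm φ i p (f p j)
    with hE
  set G : M → Matrix (Fin 4) (Fin 4) ℝ := fun p ↦ Matrix.of fun i j ↦
    g.pair (coordVec φ i) (coordVec φ j) p with hG
  have hval : ∀ p, g.volForm x p (f p) = √|(G p).det| * (E p).det := fun p ↦ by
    rw [volForm, ContinuousAlternatingMap.smul_apply, wedgeForm_apply, smul_eq_mul]
  have hgram : ∀ p ∈ φ.source, (E p).transpose * G p * E p =
      Matrix.of fun j k ↦ g.val p (f p j) (f p k) := by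
    intro p hp
    ext j k
    conv_rhs => rw [Matrix.of_apply, ← sum_coordForm_smul_coordVec hatlas hp (f p j),
      ← sum_coordForm_smul_coordVec hatlas hp (f p k)]
    simp only [Matrix.mul_apply, Matrix.transpose_apply, hE, hG, Matrix.of_apply, pair, map_sum,
      map_smul, FunLike.coe_sum, Finset.sum_apply, FunLike.coe_smul, Pi.smul_apply, smul_eq_mul,
      Finset.sum_mul, Finset.mul_sum]
    refine Finset.sum_congr rfl fun i _ ↦ Finset.sum_congr rfl fun m _ ↦ by ring
  have hdet : ∀ p ∈ φ.source, (E p).det ^ 2 * (G p).det = -1 := by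
    intro p hp
    have t := h.tetrad p
    have h1 := congrArg Matrix.det (hgram p hp)
    rw [Matrix.det_mul, Matrix.det_mul, Matrix.det_transpose] at h1
    have h2 : (Matrix.of fun j k ↦ g.val p (f p j) (f p k)) =
        !![1, 0, 0, 0; 0, 0, 0, -1; 0, 0, 1, 0; 0, -1, 0, 0] := by
      ext j k
      fin_cases j <;> fin_cases k <;>
      simp [hf, t.ss, t.aa, t.ll, t.nn, t.ln, t.ls, t.la, t.sa, t.sn, t.an,
        g.symm p (a p) (l p), g.symm p (a p) (s p), g.symm p (s p) (l p),
        g.symm p (n p)]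
    have h3 : (!![1, 0, 0, 0; 0, 0, 0, -1; 0, 0, 1, 0; 0, -1, 0, 0] :
        Matrix (Fin 4) (Fin 4) ℝ).det = -1 := by
      simp [Matrix.det_succ_row_zero, Fin.sum_univ_succ, Fin.succAbove]
    rw [h2, h3] at h1
    rw [← h1]; ring
  have hone : ∀ p ∈ φ.source, √|(G p).det| * |(E p).det| = 1 := by
    intro p hp
    rw [← Real.sqrt_sq_eq_abs (E p).det, ← Real.sqrt_mul (abs_nonneg _),
      ← abs_of_nonneg (sq_nonneg (E p).det), ← abs_mul, mul_comm, hdet p hp]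
    simp
  have hcont : ContinuousAt (fun p ↦ (E p).det) x := by
    have hXs : ∀ i j, ContinuousAt (fun p ↦ E p i j) x := by
      intro i j
      fin_cases j
      exacts [(contMDiffAt_coordForm hatlas hx (h.smooth_a x) i).continuousAt,
        (contMDiffAt_coordForm hatlas hx (h.smooth_l x) i).continuousAt,
        (contMDiffAt_coordForm hatlas hx (h.smooth_s x) i).continuousAt,
        (contMDiffAt_coordForm hatlas hx (h.smooth_n x) i).continuousAt]
    simp only [Matrix.det_apply]
    exact tendsto_finsetSum _ fun ρ _ ↦
      (tendsto_finsetProd _ fun i _ ↦ hXs (ρ i) i).const_smul _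
  have hsrc := φ.open_source.mem_nhds hx
  have hne : (E x).det ≠ 0 := fun h0 ↦ by simpa [h0] using hone x hx
  rcases lt_or_gt_of_ne hne with h0 | h0
  · refine ⟨-1, ?_⟩
    filter_upwards [hsrc, hcont.eventually_lt_const h0] with p hp hlt
    have := hone p hp
    rw [abs_of_neg hlt] at this
    rw [hval]; linarith
  · refine ⟨1, ?_⟩
    filter_upwards [hsrc, hcont.eventually_const_lt h0] with p hp hlt
    have := hone p hp
    rw [abs_of_pos hlt] at this
    rw [hval]; linarith

theorem mvfderiv_pair_eq_zero {X Y : VField M} {c : ℝ} (h : ∀ p, g.val p (X p) (Y p) = c) (x : M)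
    (v : TangentSpace (𝓡 4) x) : mvfderiv (𝓡 4) (g.pair X Y) x v = 0 := by
  have : g.pair X Y = fun _ ↦ c := funext h
  rw [this, mvfderiv_const]; rfl

theorem val_nabla_self {X : VField M} {c : ℝ} (hX : IsSmoothField X)
    (h : ∀ p, g.val p (X p) (X p) = c) (x : M) (v : TangentSpace (𝓡 4) x) :
    g.val x (g.nabla X x v) (X x) = 0 := by
  have hv : DiffFieldAt (FiberBundle.extend E4 v) x := FiberBundle.mdifferentiableAt_extend ..
  have hX' := SmoothFieldAt.diffFieldAt (hX x)
  have h1 := g.nabla_metric hv hX' hX'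
  rw [mvfderiv_pair_eq_zero h, g.symm x (X x), FiberBundle.extend_apply_self] at h1
  linarith

theorem val_nabla_swap {X Y : VField M} {c : ℝ} (hX : IsSmoothField X) (hY : IsSmoothField Y)
    (h : ∀ p, g.val p (X p) (Y p) = c) (x : M) (v : TangentSpace (𝓡 4) x) :
    g.val x (g.nabla X x v) (Y x) = -g.val x (X x) (g.nabla Y x v) := by
  have hv : DiffFieldAt (FiberBundle.extend E4 v) x := FiberBundle.mdifferentiableAt_extend ..
  have h1 := g.nabla_metric hv (SmoothFieldAt.diffFieldAt (hX x)) (SmoothFieldAt.diffFieldAt (hY x))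
  rw [mvfderiv_pair_eq_zero h, FiberBundle.extend_apply_self] at h1
  linarith

theorem val_mlieBracket_null {c : VField M} {k : ℝ} (hl : IsSmoothField l) (hc : IsSmoothField c)
    (hll : ∀ p, g.val p (l p) (l p) = 0) (hlc : ∀ p, g.val p (l p) (c p) = k) (x : M) :
    g.val x (l x) (mlieBracket (𝓡 4) l c x) = -g.val x (g.nabla l x (l x)) (c x) := by
  rw [← g.nabla_torsion_free (SmoothFieldAt.diffFieldAt (hl x)) (SmoothFieldAt.diffFieldAt (hc x)),
    map_sub, g.symm x (l x) (g.nabla l x (c x)), val_nabla_self hl hll, val_nabla_swap hl hc hlc]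
  ring

theorem val_mlieBracket_unit {b : VField M} {k : ℝ} (hl : IsSmoothField l) (hb : IsSmoothField b)
    (hbb : ∀ p, g.val p (b p) (b p) = k) (x : M) :
    g.val x (b x) (mlieBracket (𝓡 4) l b x) = -g.val x (g.nabla l x (b x)) (b x) := by
  rw [← g.nabla_torsion_free (SmoothFieldAt.diffFieldAt (hl x)) (SmoothFieldAt.diffFieldAt (hb x)),
    map_sub, g.symm x (b x) (g.nabla b x (l x)), val_nabla_self hb hbb, g.symm x (b x)]
  ring

variable {b c : VField M} {w : M → ℝ} {x : M}

/-- In Cartan's formula only the derivative of `η(b, n) = -w` and the brackets `[l, b]`, `[l, n]`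
survive. Leaving `b` general lets the formula serve both `F` (with `b = a`) and `*F` (with `b = s`).
-/
theorem extD_wedge_apply_transverse (hl : IsSmoothField l) (hb : IsSmoothField b)
    (hn : IsSmoothField n) (hw : ContMDiffAt (𝓡 4) 𝓘(ℝ, ℝ) ∞ w x)
    (hll : ∀ p, g.val p (l p) (l p) = 0) (hlb : ∀ p, g.val p (l p) (b p) = 0)
    (hbb : ∀ p, g.val p (b p) (b p) = 1) (hln : ∀ p, g.val p (l p) (n p) = -1)
    (hbn : ∀ p, g.val p (b p) (n p) = 0) :
    extD (fun p ↦ w p • wedgeForm ![g.val p (b p), g.val p (l p)]) x ![l x, b x, n x] =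
      -mvfderiv (𝓡 4) w x (l x) - w x * g.val x (g.nabla l x (b x)) (b x)
        + w x * g.val x (g.nabla l x (l x)) (n x) := by
  set η : FormField 2 M := fun p ↦ w p • wedgeForm ![g.val p (b p), g.val p (l p)] with hη
  have hv : ∀ p u v, η p ![u, v] = w p * (g.val p (b p) u * g.val p (l p) v -
      g.val p (b p) v * g.val p (l p) u) := fun p u v ↦ by
    rw [hη, ContinuousAlternatingMap.smul_apply, wedgeForm_two, smul_eq_mul]
  have hbl : ∀ p, g.val p (b p) (l p) = 0 := fun p ↦ (g.symm p _ _).trans (hlb p)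
  have e1 : (fun p ↦ η p ![b p, n p]) = -w := by
    ext p; simp [hv, hbb, hln, hbn]
  have e2 : (fun p ↦ η p ![l p, n p]) = fun _ ↦ 0 := by
    ext p; simp [hv, hbl, hll]
  have e3 : (fun p ↦ η p ![l p, b p]) = fun _ ↦ 0 := by
    ext p; simp [hv, hbl, hll, hlb]
  have hw' : MDifferentiableAt (𝓡 4) 𝓘(ℝ, ℝ) w x := hw.mdifferentiableAt (by simp)
  rw [extD_apply ((contDiffAt_chartPullback_wedge hw (hb x) (hl x)).differentiableAt (by simp))
    (SmoothFieldAt.diffFieldAt (hl x)) (SmoothFieldAt.diffFieldAt (hb x))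
    (SmoothFieldAt.diffFieldAt (hn x)) (e3 ▸ mdifferentiableAt_const)
    (e2 ▸ mdifferentiableAt_const) (e1 ▸ hw'.neg), e1, e2, e3, hv, hv, hv, hll, hlb, hbl, hbb, hbn,
    hln, mvfderiv_const, mvfderiv_neg, val_mlieBracket_null hl hn hll hln,
    val_mlieBracket_unit hl hb hbb]
  simp

/-- All the components of the form on these fields vanish identically, and of the brackets only `[l,
c]` contributes. -/
theorem extD_wedge_apply_tangent (hl : IsSmoothField l) (hb : IsSmoothField b)
    (hc : IsSmoothField c) (hw : ContMDiffAt (𝓡 4) 𝓘(ℝ, ℝ) ∞ w x)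
    (hll : ∀ p, g.val p (l p) (l p) = 0) (hlb : ∀ p, g.val p (l p) (b p) = 0)
    (hbb : ∀ p, g.val p (b p) (b p) = 1) (hlc : ∀ p, g.val p (l p) (c p) = 0)
    (hbc : ∀ p, g.val p (b p) (c p) = 0) :
    extD (fun p ↦ w p • wedgeForm ![g.val p (b p), g.val p (l p)]) x ![l x, b x, c x] =
      w x * g.val x (g.nabla l x (l x)) (c x) := by
  set η : FormField 2 M := fun p ↦ w p • wedgeForm ![g.val p (b p), g.val p (l p)] with hη
  have hv : ∀ p u v, η p ![u, v] = w p * (g.val p (b p) u * g.val p (l p) v -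
      g.val p (b p) v * g.val p (l p) u) := fun p u v ↦ by
    rw [hη, ContinuousAlternatingMap.smul_apply, wedgeForm_two, smul_eq_mul]
  have hbl : ∀ p, g.val p (b p) (l p) = 0 := fun p ↦ (g.symm p _ _).trans (hlb p)
  have e1 : (fun p ↦ η p ![b p, c p]) = fun _ ↦ 0 := by
    ext p; simp [hv, hlb, hlc, hbc]
  have e2 : (fun p ↦ η p ![l p, c p]) = fun _ ↦ 0 := by
    ext p; simp [hv, hbl, hll]
  have e3 : (fun p ↦ η p ![l p, b p]) = fun _ ↦ 0 := by
    ext p; simp [hv, hbl, hll, hlb]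
  rw [extD_apply ((contDiffAt_chartPullback_wedge hw (hb x) (hl x)).differentiableAt (by simp))
    (SmoothFieldAt.diffFieldAt (hl x)) (SmoothFieldAt.diffFieldAt (hb x))
    (SmoothFieldAt.diffFieldAt (hc x)) (e3 ▸ mdifferentiableAt_const)
    (e2 ▸ mdifferentiableAt_const) (e1 ▸ mdifferentiableAt_const), e1, e2, e3, hv, hv, hv, hll, hlb,
    hbl, hbb, hbc, hlc, mvfderiv_const,
    val_mlieBracket_null hl hc hll hlc]
  simp

/-- A closed 2-form `w α ∧ l♭` satisfies the force-free condition if `l` is pregeodesic and has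
equal expansions along `s` and `a`. -/
theorem IsAdaptedFrame.intProd_currentVec (h : g.IsAdaptedFrame D s l a n)
    (hexp : g.val x (g.nabla l x (s x)) (s x) = g.val x (g.nabla l x (a x)) (a x))
    (hgeo : g.val x (g.nabla l x (l x)) (a x) = 0) {F : FormField 2 M}
    (hw : ContMDiffAt (𝓡 4) 𝓘(ℝ, ℝ) ∞ w x)
    (hF : ∀ᶠ p in 𝓝 x, F p = w p • wedgeForm ![g.val p (a p), g.val p (l p)])
    (hd : extD F x = 0) : intProd (g.currentVec F x) (F x) = 0 := by
  have t := h.tetrad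
  have ll := fun p ↦ (t p).ll
  have ls := fun p ↦ (t p).ls
  have la := fun p ↦ (t p).la
  have ss := fun p ↦ (t p).ss
  have aa := fun p ↦ (t p).aa
  have ln := fun p ↦ (t p).ln
  have sn := fun p ↦ (t p).sn
  have an := fun p ↦ (t p).an
  have sa := fun p ↦ (t p).sa
  obtain ⟨σ, hσ⟩ := h.exists_volForm_eventually_eq x
  have hstar : ∀ᶠ p in 𝓝 x, g.hodge₂ (g.volForm x) F p =
      ((fun _ ↦ -σ) * w : M → ℝ) p • wedgeForm ![g.val p (s p), g.val p (l p)] := by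
    filter_upwards [hσ, hF] with p hp hFp
    rw [(t p).hodge₂_eq (g.volForm x) hFp, hp, Pi.mul_apply]
    congr 1; ring
  have hw' : ContMDiffAt (𝓡 4) 𝓘(ℝ, ℝ) ∞ ((fun _ ↦ -σ) * w : M → ℝ) x := contMDiffAt_const.mul hw
  -- Closedness of `F` on `(l, a, n)` is a transport equation for `w` along `l`; with equal
  -- expansions it is also the one needed for `*F` on `(l, s, n)`.
  have hdF := extD_wedge_apply_transverse h.smooth_l h.smooth_a h.smooth_n hw ll la aa ln an
  rw [← extD_congr hF, hd] at hdF
  refine (t x).intProd_currentVec hF.self_of_nhds ?_ ?_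
  · rw [extD_congr hstar, extD_wedge_apply_tangent h.smooth_l h.smooth_s h.smooth_a hw' ll ls ss la
      sa, hgeo, mul_zero]
  · rw [extD_congr hstar, extD_wedge_apply_transverse h.smooth_l h.smooth_s h.smooth_n hw' ll ls ss
      ln sn, mvfderiv_mul mdifferentiableAt_const (hw.mdifferentiableAt (by simp)), mvfderiv_const,
      hexp]
    simp at hdF ⊢
    linear_combination σ * hdF

end LorentzMetric

end ForceFree

/-! ### Equipartition, its invariance under rotation, and the resulting fields -/

section FieldSheets

set_option linter.unusedSectionVars false

open Set Filter Topology

variable {M : Type*} [TopologicalSpace M] [ChartedSpace E4 M] [IsManifold (𝓡 4) ∞ M]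

theorem isSmoothFormOn_congr {k : ℕ} {η η' : FormField k M} {U : Set M} (hU : IsOpen U)
    (h : ∀ p ∈ U, η p = η' p) (hη' : IsSmoothFormOn η' U) : IsSmoothFormOn η U := by
  intro x hx
  have hc : Tendsto (extChartAt (𝓡 4) x).symm (𝓝 (extChartAt (𝓡 4) x x)) (𝓝 x) := by
    have := continuousAt_extChartAt_symm (I := 𝓡 4) x
    rwa [ContinuousAt, extChartAt_to_inv] at this
  refine (hη' x hx).congr_of_eventuallyEq ?_
  filter_upwards [hc.eventually (hU.mem_nhds hx)] with y hy
  simp only [chartPullback, h _ hy]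

namespace LorentzMetric

variable {g : LorentzMetric M} {D : PlaneField M} {s l a n : VField M}

theorem nabla_add {X : VField M} {x : M} (hX : DiffFieldAt X x) (v w : TangentSpace (𝓡 4) x) :
    g.nabla X x (v + w) = g.nabla X x v + g.nabla X x w := by
  simp only [nabla, dif_pos hX, sharp, map_add, smul_add]

theorem nabla_smul {X : VField M} {x : M} (hX : DiffFieldAt X x) (c : ℝ)
    (v : TangentSpace (𝓡 4) x) : g.nabla X x (c • v) = c • g.nabla X x v := by
  simp only [nabla, dif_pos hX, sharp, map_smul, smul_comm c]

/-- Because `l₀` and `l` are orthogonal to `c`, metric compatibility moves the derivative onto `c`.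
Thus `f` is never differentiated and needs no regularity. -/
theorem val_nabla_multiple {l₀ c : VField M} (hl₀ : IsSmoothField l₀) (hl : IsSmoothField l)
    (hc : IsSmoothField c) {f : M → ℝ} (hf : ∀ p, l₀ p = f p • l p)
    (hlc : ∀ p, g.val p (l p) (c p) = 0) (x : M) (v : TangentSpace (𝓡 4) x) :
    g.val x (g.nabla l₀ x v) (c x) = f x * g.val x (g.nabla l x v) (c x) := by
  have h0 : ∀ p, g.val p (l₀ p) (c p) = 0 := fun p ↦ by simp [hf, hlc]
  rw [val_nabla_swap hl₀ hc h0, val_nabla_swap hl hc hlc, hf]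
  simp

theorem IsFieldSheetCongruence.exists_multiple {l₀ : VField M}
    (h₀ : g.IsFieldSheetCongruence D l₀) (h : g.IsAdaptedFrame D s l a n) :
    ∃ f : M → ℝ, ∀ p, f p ≠ 0 ∧ l₀ p = f p • l p := by
  have : ∀ p, ∃ c : ℝ, c ≠ 0 ∧ l₀ p = c • l p := by
    intro p
    have t := h.tetrad p
    have hm := h₀.tangent p
    rw [t.span_eq, Submodule.mem_span_pair] at hm
    obtain ⟨c, d, hcd⟩ := hm
    have hnull := h₀.congruence.null p
    rw [← hcd] at hnull
    simp [t.ll, t.ls, t.ss, g.symm p (s p) (l p)] at hnull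
    rw [hnull, zero_smul, add_zero] at hcd
    refine ⟨c, ?_, hcd.symm⟩
    rintro rfl
    exact h₀.congruence.ne_zero p (by rw [← hcd, zero_smul])
  choose f hf using this
  exact ⟨f, hf⟩

/-- `l` is pregeodesic, and its expansions along `s` and `a` are equal. -/
structure IsEquipartitioned (g : LorentzMetric M) (s l a : VField M) : Prop where
  ls : ∀ x, g.val x (g.nabla l x (l x)) (s x) = 0
  la : ∀ x, g.val x (g.nabla l x (l x)) (a x) = 0
  expansion : ∀ x, g.val x (g.nabla l x (s x)) (s x) = g.val x (g.nabla l x (a x)) (a x)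

theorem IsFieldSheetCongruence.isEquipartitioned {l₀ : VField M}
    (h₀ : g.IsFieldSheetCongruence D l₀) (h : g.IsAdaptedFrame D s l a n) :
    g.IsEquipartitioned s l a := by
  obtain ⟨f, hf⟩ := h₀.exists_multiple h
  have t := h.tetrad
  have ls := fun p ↦ (t p).ls
  have la := fun p ↦ (t p).la
  have hf2 := fun p ↦ (hf p).2
  have hs := val_nabla_multiple (c := s) h₀.congruence.smooth h.smooth_l h.smooth_s hf2 ls
  have ha := val_nabla_multiple (c := a) h₀.congruence.smooth h.smooth_l h.smooth_a hf2 la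
  have hdiff := fun x ↦ SmoothFieldAt.diffFieldAt (h₀.congruence.smooth x)
  -- Pairing `∇_{l₀} l₀ = k l₀` with `c` gives `f² g(∇_l l, c) = 0`.
  have hgeo : ∀ (c : VField M), (∀ p, g.val p (l p) (c p) = 0) →
      (∀ x v, g.val x (g.nabla l₀ x v) (c x) = f x * g.val x (g.nabla l x v) (c x)) →
      ∀ x, g.val x (g.nabla l x (l x)) (c x) = 0 := by
    intro c hlc hc x
    obtain ⟨k, hk⟩ := h₀.congruence.pregeodesic x
    have h1 := congrArg (fun v ↦ g.val x v (c x)) hk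
    simp only [hf2, nabla_smul (hdiff x), map_smul, FunLike.coe_smul, Pi.smul_apply, smul_eq_mul,
      hlc, mul_zero, hc] at h1
    simpa [(hf x).1] using h1
  refine ⟨hgeo s ls hs, hgeo a la ha, fun x ↦ ?_⟩
  have hfx := (hf x).1
  -- Equipartition concerns tetrads containing `l₀`, so `n` is rescaled inversely to keep the
  -- product `-1`.
  have t0 : g.IsAdaptedTetrad D x (s x) (l₀ x) (a x) ((f x)⁻¹ • n x) := by
    refine ⟨?_, ?_, ?_, (t x).ss, (t x).aa, ?_, ?_, ?_, (t x).sa, ?_, ?_⟩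
    · rw [(t x).span_eq, hf2, Submodule.span_insert, Submodule.span_insert,
        Submodule.span_singleton_smul_eq (IsUnit.mk0 _ hfx)]
    · simp [hf2, (t x).ll]
    · simp [(t x).nn]
    · simp [hf2, (t x).ln, hfx]
    · simp [hf2, (t x).ls]
    · simp [hf2, (t x).la]
    · simp [(t x).sn]
    · simp [(t x).an]
  have h1 := h₀.equipartition x _ _ _ t0
  rw [nullMeanCurvature, hs, ha] at h1
  exact mul_left_cancel₀ hfx (by linarith)

/-- Any other adapted tetrad containing `l₀` has `s' = c l + d s` and `a' = p l + q a` with `d² = q²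
= 1`. The `l`-terms do not affect the expansions, since `∇_v l₀` is orthogonal to `l` and `∇_l l₀`
to `s` and `a`. -/
theorem IsEquipartitioned.isFieldSheetCongruence {l₀ : VField M}
    (he : g.IsEquipartitioned s l a) (h : g.IsAdaptedFrame D s l a n)
    (h₀ : g.IsNullGeodesicCongruence l₀) {f : M → ℝ} (hf : ∀ p, f p ≠ 0 ∧ l₀ p = f p • l p) :
    g.IsFieldSheetCongruence D l₀ := by
  have hf2 := fun p ↦ (hf p).2
  refine ⟨h₀, fun x ↦ ?_, fun x s' a' n' t' ↦ ?_⟩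
  · rw [(h.tetrad x).span_eq, hf2]
    exact Submodule.smul_mem _ _ (Submodule.subset_span (by simp))
  have t := h.tetrad x
  have hs := val_nabla_multiple (c := s) h₀.smooth h.smooth_l h.smooth_s hf2
    (fun p ↦ (h.tetrad p).ls) x
  have ha := val_nabla_multiple (c := a) h₀.smooth h.smooth_l h.smooth_a hf2
    (fun p ↦ (h.tetrad p).la) x
  have hl : ∀ v, g.val x (g.nabla l₀ x v) (l x) = 0 := fun v ↦ by
    have h1 := val_nabla_self h₀.smooth h₀.null x v
    rw [hf2, map_smul, smul_eq_mul] at h1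
    exact (mul_eq_zero.1 h1).resolve_left (hf x).1
  have hd := SmoothFieldAt.diffFieldAt (h₀.smooth x)
  have hla' : g.val x (l x) a' = 0 := by
    have h1 := t'.la
    simp only [hf2, map_smul, FunLike.coe_smul, Pi.smul_apply, smul_eq_mul] at h1
    exact (mul_eq_zero.1 h1).resolve_left (hf x).1
  have hm : s' ∈ Submodule.span ℝ {l x, s x} := by
    rw [← t.span_eq, t'.span_eq]
    exact Submodule.subset_span (by simp)
  obtain ⟨c, d, rfl⟩ := Submodule.mem_span_pair.1 hm
  have hsl : g.val x (s x) (l x) = 0 := (g.symm x _ _).trans t.ls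
  have hal : g.val x (a x) (l x) = 0 := (g.symm x _ _).trans t.la
  have hd1 : d * d = 1 := by
    have h1 := t'.ss
    simpa [t.ll, t.ls, t.ss, hsl] using h1
  have hd0 : d ≠ 0 := by rintro rfl; simp at hd1
  have hsa' : g.val x (s x) a' = 0 := by
    have h1 := t'.sa
    simpa [hla', hd0] using h1
  have hexp := t.expand a'
  rw [g.symm x a' (l x), hla', g.symm x a' (s x), hsa', zero_smul, zero_smul, sub_zero,
    add_zero] at hexp
  generalize -g.val x a' (n x) = p at hexp
  generalize g.val x a' (a x) = q at hexp
  subst hexp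
  have hq1 : q * q = 1 := by
    have h1 := t'.aa
    simpa [t.ll, t.la, t.aa, hal] using h1
  have e1 : g.val x (g.nabla l₀ x (c • l x + d • s x)) (c • l x + d • s x) =
      f x * g.val x (g.nabla l x (s x)) (s x) := by
    simp only [nabla_add hd, nabla_smul hd, map_add, map_smul, FunLike.coe_add, Pi.add_apply,
      FunLike.coe_smul, Pi.smul_apply, smul_eq_mul, hl, hs, he.ls x]
    linear_combination (f x * g.val x (g.nabla l x (s x)) (s x)) * hd1
  have e2 : g.val x (g.nabla l₀ x (p • l x + q • a x)) (p • l x + q • a x) =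
      f x * g.val x (g.nabla l x (a x)) (a x) := by
    simp only [nabla_add hd, nabla_smul hd, map_add, map_smul, FunLike.coe_add, Pi.add_apply,
      FunLike.coe_smul, Pi.smul_apply, smul_eq_mul, hl, ha, he.la x]
    linear_combination (f x * g.val x (g.nabla l x (a x)) (a x)) * hq1
  rw [nullMeanCurvature, e1, e2, he.expansion x]
  ring

theorem IsAdaptedFrame.isNullFoliation (h : g.IsAdaptedFrame D s l a n) (hD : IsFoliation D) :
    g.IsNullFoliation D := by
  refine ⟨hD, fun x ↦ ⟨l x, ?_, fun h0 ↦ ?_, fun w hw ↦ ?_⟩⟩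
  · rw [(h.tetrad x).span_eq]; exact Submodule.subset_span (by simp)
  · have := (h.tetrad x).ln
    simp [h0] at this
  · rw [(h.tetrad x).span_eq] at hw
    obtain ⟨c, d, rfl⟩ := Submodule.mem_span_pair.1 hw
    simp [(h.tetrad x).ll, (h.tetrad x).ls]

/-! ### Rotation of the screen vectors -/

section Rotation

variable {A B : M → ℝ}

theorem IsAdaptedFrame.rotate (h : g.IsAdaptedFrame D s l a n)
    (hA : ContMDiff (𝓡 4) 𝓘(ℝ, ℝ) ∞ A) (hB : ContMDiff (𝓡 4) 𝓘(ℝ, ℝ) ∞ B)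
    (hAB : ∀ x, A x * A x + B x * B x = 1) :
    g.IsAdaptedFrame (spanField l (A • s + B • a)) (A • s + B • a) l (-B • s + A • a) n := by
  refine ⟨?_, h.smooth_l, ?_, h.smooth_n, fun x ↦ ?_⟩
  · exact (hA.smul_section h.smooth_s).add_section (hB.smul_section h.smooth_a)
  · exact (hB.neg.smul_section h.smooth_s).add_section (hA.smul_section h.smooth_a)
  have t := h.tetrad x
  have hsa := t.sa ▸ g.symm x (a x) (s x)
  refine ⟨rfl, t.ll, t.nn, ?_, ?_, t.ln, ?_, ?_, ?_, ?_, ?_⟩ <;>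
    simp [t.ss, t.aa, t.ls, t.la, t.sa, t.sn, t.an, hsa]
  · exact hAB x
  · linarith [hAB x]
  · ring

/-- The difference of the two expansions transforms with the doubled angle: it becomes `A² - B²`
times the old difference plus `2AB` times the off-diagonal sum, and both vanish. -/
theorem IsEquipartitioned.rotate (he : g.IsEquipartitioned s l a) (hl : IsSmoothField l)
    (hu : g.UniformEquipartition s l a) :
    g.IsEquipartitioned (A • s + B • a) l (-B • s + A • a) := by
  refine ⟨fun x ↦ ?_, fun x ↦ ?_, fun x ↦ ?_⟩
  · simp [he.ls, he.la]
  · simp [he.ls, he.la]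
  · have hd := SmoothFieldAt.diffFieldAt (hl x)
    have h1 := hu x
    have h2 := he.expansion x
    simp only [Pi.add_apply, Pi.smul_apply', Pi.neg_apply, nabla_add hd, nabla_smul hd, map_add,
      map_smul, FunLike.coe_add, FunLike.coe_smul, Pi.smul_apply, smul_eq_mul]
    linear_combination (A x * A x - B x * B x) * h2 + 2 * A x * B x * h1

end Rotation

/-! ### Force-free fields from adapted charts -/

section ChartFields

variable {φ : OpenPartialHomeomorph M E4}

/-- The first two coordinate vectors lie in `D`, so a covector annihilating `D` has no components
along them. -/
theorem val_eq_of_adapted (hφ : IsAdaptedChart D φ) {x : M} (hx : x ∈ φ.source)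
    {b : VField M} (hb : ∀ v ∈ D x, g.val x (b x) v = 0) (v : TangentSpace (𝓡 4) x) :
    g.val x (b x) v = g.pair b (coordVec φ 2) x * coordForm φ 2 x v +
      g.pair b (coordVec φ 3) x * coordForm φ 3 x v := by
  have hc := coordForm_coordVec hφ.mem_atlas hx
  have h0 := hb (coordVec φ 0 x) ((hφ.mem_iff x hx _).2 (by simp [hc]))
  have h1 := hb (coordVec φ 1 x) ((hφ.mem_iff x hx _).2 (by simp [hc]))
  conv_lhs => rw [← sum_coordForm_smul_coordVec hφ.mem_atlas hx v]
  simp only [map_add, map_smul, Fin.sum_univ_four, h0, h1, smul_eq_mul, pair]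
  ring

theorem IsAdaptedFrame.wedge_eq (h : g.IsAdaptedFrame D s l a n) (hφ : IsAdaptedChart D φ)
    {x : M} (hx : x ∈ φ.source) :
    wedgeForm ![g.val x (a x), g.val x (l x)] =
      (g.pair a (coordVec φ 2) x * g.pair l (coordVec φ 3) x -
        g.pair a (coordVec φ 3) x * g.pair l (coordVec φ 2) x) •
      wedgeForm ![coordForm φ 2 x, coordForm φ 3 x] := by
  have t := h.tetrad x
  have ha := val_eq_of_adapted (g := g) hφ hx (b := a) fun v hv ↦ by
    rw [t.span_eq] at hv
    obtain ⟨c, d, rfl⟩ := Submodule.mem_span_pair.1 hv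
    simp [g.symm x (a x), t.la, t.sa]
  have hl := val_eq_of_adapted (g := g) hφ hx (b := l) fun v hv ↦ by
    rw [t.span_eq] at hv
    obtain ⟨c, d, rfl⟩ := Submodule.mem_span_pair.1 hv
    simp [t.ll, t.ls]
  ext v
  have hv : v = ![v 0, v 1] := by ext1 i; fin_cases i <;> rfl
  rw [hv, ContinuousAlternatingMap.smul_apply, wedgeForm_two, wedgeForm_two, ha, hl, ha, hl,
    smul_eq_mul]
  ring

theorem IsAdaptedFrame.kappa_inv_ne_zero (h : g.IsAdaptedFrame D s l a n)
    (hφ : IsAdaptedChart D φ) {x : M} (hx : x ∈ φ.source) :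
    g.pair a (coordVec φ 2) x * g.pair l (coordVec φ 3) x -
      g.pair a (coordVec φ 3) x * g.pair l (coordVec φ 2) x ≠ 0 := by
  intro h0
  -- The wedge `a♭ ∧ l♭` takes the value `-1` on `(a, n)`, so its coefficient cannot vanish.
  have h1 := congrArg (fun β ↦ β ![a x, n x]) (h.wedge_eq hφ hx)
  have t := h.tetrad x
  simp [h0, wedgeForm_two, t.aa, t.an, t.ln] at h1

theorem IsAdaptedFrame.chartField_eq (h : g.IsAdaptedFrame D s l a n) (hφ : IsAdaptedChart D φ)
    (u : ℝ → ℝ → ℝ) {x : M} (hx : x ∈ φ.source) :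
    g.chartField φ u a l x = transverseForm φ u x := by
  rw [chartField, h.wedge_eq hφ hx, smul_smul, kappa, mul_assoc,
    inv_mul_cancel₀ (h.kappa_inv_ne_zero hφ hx), mul_one, transverseForm]

theorem _root_.IsAdaptedChart.mem_iff_intProd (hφ : IsAdaptedChart D φ) {u : ℝ → ℝ → ℝ} {x : M}
    (hx : x ∈ φ.source) (hu : u (φ x 2) (φ x 3) ≠ 0) (v : TangentSpace (𝓡 4) x) :
    v ∈ D x ↔ intProd v (transverseForm φ u x) = 0 := by
  have hv : ∀ w : Fin 1 → TangentSpace (𝓡 4) x, intProd v (transverseForm φ u x) w =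
      u (φ x 2) (φ x 3) * (coordForm φ 2 x v * coordForm φ 3 x (w 0) -
        coordForm φ 2 x (w 0) * coordForm φ 3 x v) := fun w ↦ by
    rw [intProd_apply, (by ext1 i; fin_cases i <;> rfl : Matrix.vecCons v w = ![v, w 0]),
      transverseForm, ContinuousAlternatingMap.smul_apply, wedgeForm_two, smul_eq_mul]
  rw [hφ.mem_iff x hx]
  refine ⟨fun h0 ↦ ?_, fun h0 ↦ ?_⟩
  · ext w
    rw [hv, h0.1, h0.2]
    simp
  · have hc := coordForm_coordVec hφ.mem_atlas hx
    have h2 := hv ![coordVec φ 2 x]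
    have h3 := hv ![coordVec φ 3 x]
    rw [h0] at h2 h3
    simp [hc, hu] at h2 h3
    exact ⟨h3, h2⟩

theorem IsAdaptedFrame.isNullForceFreeOn_chartField (h : g.IsAdaptedFrame D s l a n)
    (he : g.IsEquipartitioned s l a) (hφ : IsAdaptedChart D φ) {u : ℝ → ℝ → ℝ}
    (hu : ContDiffOn ℝ ∞ (fun y : ℝ × ℝ ↦ u y.1 y.2) ((fun x ↦ (φ x 2, φ x 3)) '' φ.source)) :
    g.IsNullForceFreeOn (g.chartField φ u a l) φ.source := by
  have heq : ∀ p ∈ φ.source, g.chartField φ u a l p = transverseForm φ u p :=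
    fun p hp ↦ h.chartField_eq hφ u hp
  have hd : ∀ x ∈ φ.source, extD (g.chartField φ u a l) x = 0 := fun x hx ↦ by
    rw [extD_congr (eventually_of_mem (φ.open_source.mem_nhds hx) heq),
      extD_transverseForm hφ.mem_atlas hu hx]
  refine ⟨isSmoothFormOn_congr φ.open_source heq (isSmoothFormOn_transverseForm hφ.mem_atlas hu),
    hd, fun x hx ↦ ?_, fun x hx ↦ ?_⟩
  · have hw : ContMDiffAt (𝓡 4) 𝓘(ℝ, ℝ) ∞ (fun p ↦ u (φ p 2) (φ p 3) * g.kappa φ a l p) x := by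
      have hc := smoothFieldAt_coordVec hφ.mem_atlas hx
      have hp : ∀ {b : VField M}, IsSmoothField b → ∀ i,
          ContMDiffAt (𝓡 4) 𝓘(ℝ, ℝ) ∞ (g.pair b (coordVec φ i)) x :=
        fun hb i ↦ contMDiffAt_pair (hb x) (hc i)
      exact (contMDiffAt_transverse hφ.mem_atlas hu hx).mul
        ((((hp h.smooth_a 2).mul (hp h.smooth_l 3)).sub
          ((hp h.smooth_a 3).mul (hp h.smooth_l 2))).inv₀ (h.kappa_inv_ne_zero hφ hx))
    exact h.intProd_currentVec (he.expansion x) (he.la x) hw (Eventually.of_forall fun _ ↦ rfl)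
      (hd x hx)
  · have t := h.tetrad x
    rw [formSq_wedge (F := g.chartField φ u a l) (x := x) rfl, t.ll, g.symm x (a x) (l x), t.la]
    ring

end ChartFields

end LorentzMetric

end FieldSheets

end

theorem mainTheorem5 {M : Type*} [TopologicalSpace M] [T2Space M] [SecondCountableTopology M]
    [ChartedSpace E4 M] [IsManifold (𝓡 4) ∞ M] (g : LorentzMetric M)
    (D : PlaneField M) (hD : g.IsNullFieldSheetFoliation D)
    (s l a n : VField M) (hframe : g.IsAdaptedFrame D s l a n)
    (huniform : g.UniformEquipartition s l a)
    (A B : M → ℝ) (hA : ContMDiff (𝓡 4) 𝓘(ℝ, ℝ) ∞ A) (hB : ContMDiff (𝓡 4) 𝓘(ℝ, ℝ) ∞ B)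
    (hunit : ∀ x, g.pair (A • s + B • a) (A • s + B • a) x = 1)
    (hint : IsFoliation (spanField l (A • s + B • a))) :
    g.IsNullFieldSheetFoliation (spanField l (A • s + B • a)) ∧
    (∀ l₀ : VField M, g.IsFieldSheetCongruence D l₀ →
      g.IsFieldSheetCongruence (spanField l (A • s + B • a)) l₀) ∧
    g.IsAdaptedFrame (spanField l (A • s + B • a)) (A • s + B • a) l (-B • s + A • a) n ∧
    ∀ φ : OpenPartialHomeomorph M E4, IsAdaptedChart (spanField l (A • s + B • a)) φ →
      ∀ u : ℝ → ℝ → ℝ,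
        ContDiffOn ℝ ∞ (fun y : ℝ × ℝ ↦ u y.1 y.2) ((fun x ↦ (φ x 2, φ x 3)) '' φ.source) →
        g.IsNullForceFreeOn (g.chartField φ u (-B • s + A • a) l) φ.source ∧
        ∀ x ∈ φ.source,
          g.chartField φ u (-B • s + A • a) l x =
            u (φ x 2) (φ x 3) • wedgeForm ![coordForm φ 2 x, coordForm φ 3 x] ∧
          (u (φ x 2) (φ x 3) ≠ 0 → ∀ v : TangentSpace (𝓡 4) x,
            v ∈ spanField l (A • s + B • a) x ↔
              intProd v (g.chartField φ u (-B • s + A • a) l x) = 0) := by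
  have hAB : ∀ x, A x * A x + B x * B x = 1 := fun x ↦ by
    have t := hframe.tetrad x
    have h1 := hunit x
    simpa [LorentzMetric.pair, t.ss, t.aa, t.sa, g.symm x (a x) (s x)] using h1
  obtain ⟨l₁, hl₁⟩ := hD.exists_congruence
  have hframe' := hframe.rotate hA hB hAB
  -- A single field sheet congruence `l₁` suffices to equipartition the frame; every other one is
  -- then handled through its own multiple `f` of `l`.
  have he' := (hl₁.isEquipartitioned hframe).rotate (A := A) (B := B) hframe.smooth_l huniform
  have hcong : ∀ l₀ : VField M, g.IsFieldSheetCongruence D l₀ →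
      g.IsFieldSheetCongruence (spanField l (A • s + B • a)) l₀ := fun l₀ h₀ ↦ by
    obtain ⟨f, hf⟩ := h₀.exists_multiple hframe
    exact he'.isFieldSheetCongruence hframe' h₀.congruence hf
  refine ⟨⟨hframe'.isNullFoliation hint, l₁, hcong l₁ hl₁⟩, hcong, hframe', fun φ hφ u hu ↦
    ⟨hframe'.isNullForceFreeOn_chartField he' hφ hu, fun x hx ↦ ⟨hframe'.chartField_eq hφ u hx,
      fun hux v ↦ ?_⟩⟩⟩
  rw [hframe'.chartField_eq hφ u hx]
  exact hφ.mem_iff_intProd hx hux v
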